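/- For an immersion $c\in C^\infty([0,2\pi],\mathbb R^2)$ (that is, $c'(\theta)\neq 0$ for all $\theta$) write $D_s=\frac{1}{|c'|}\partial_\theta$, $ds=|c'|\,d\theta$, $v=D_sc$ for the unit tangent and $n$ for $v$ rotated by $+\pi/2$. Let $\mathrm{Imm}([0,2\pi],\mathbb R^2)/\mathrm{Mot}$ be the space of such open curves modulo Euclidean motions (translations and rotations), identified with the set of immersions $c$ with $c(0)=0$ and $v(0)=(1,0)$. This is an open subset of the Fréchet space of all $h\in C^\infty([0,2\pi],\mathbb R^2)$ with $h(0)=0$ and $h'(0)\in\mathbb R\times\{0\}$, so that its tangent space at $c$ is $$T_c=\{h\in C^\infty([0,2\pi],\mathbb R^2): h(0)=0,\ \langle D_sh(0),n(0)\rangle=0\}.$$ Equip it with the weak Riemannian metric $$G_c(h,k)=\int_0^{2\pi}\langle D_sh,v\rangle\langle D_sk,v\rangle+\langle D_s^2h,n\rangle\langle D_s^2k,n\rangle\,ds .$$ Then $G$ has a unique (smooth) Levi-Civita connection, and for every $c$ and all linearly independent $h,k\in T_c$ one has $G_c(h,h)G_c(k,k)-G_c(h,k)^2>0$, and the sectional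 curvature $\frac{G_c(R(h,k)k,h)}{G_c(h,h)G_c(k,k)-G_c(h,k)^2}$ of the plane spanned by $h,k$, where $R(X,Y)Z=\nabla_X\nabla_YZ-\nabla_Y\nabla_XZ-\nabla_{[X,Y]}Z$, equals $$\mathrm k_c(P(h,k))=\frac{-3\int_0^{2\pi}\big(\langle D_sh,v\rangle\langle D_s^2k,n\rangle-\langle D_sk,v\rangle\langle D_s^2h,n\rangle\big)^2\,ds}{G_c(h,h)G_c(k,k)-G_c(h,k)^2}.$$ In particular the sectional curvature is non-positive. -/

import Mathlib

open scoped ContDiff InnerProductSpace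

noncomputable section

namespace PlaneCurves

/-- The Euclidean plane. -/
abbrev Plane : Type := EuclideanSpace ℝ (Fin 2)

/-- The parameter interval `[0, 2π]`. -/
abbrev J : Set ℝ := Set.Icc 0 (2 * Real.pi)

/-- A map `[0, 2π] → ℝ²`, extended to the real line by its end values. All notions below only
depend on the restriction of the extended map to `[0, 2π]`. -/
def ext (f : J → Plane) : ℝ → Plane := Set.IccExtend Real.two_pi_pos.le f

/-- The derivative `f' = ∂_θ f` on `[0, 2π]` (one-sided at the end points). -/
def dθ (f : ℝ → Plane) : ℝ → Plane := fun θ => derivWithin f J θ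

/-- The length element `|c'|`. -/
def speed (c : ℝ → Plane) : ℝ → ℝ := fun θ => ‖dθ c θ‖

/-- The arc length derivative `D_s = |c'|⁻¹ ∂_θ` along `c`. -/
def Ds (c f : ℝ → Plane) : ℝ → Plane := fun θ => (speed c θ)⁻¹ • dθ f θ

/-- The unit tangent vector `v = D_s c`. -/
def unitTangent (c : ℝ → Plane) : ℝ → Plane := Ds c c

/-- The rotation by `π / 2`. -/
def rot (x : Plane) : Plane := !₂[-x 1, x 0]

/-- The unit normal vector `n`, the tangent `v` rotated by `π / 2`. -/
def unitNormal (c : ℝ → Plane) : ℝ → Plane := fun θ => rot (unitTangent c θ)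

/-- The tangential component `⟨D_s h, v⟩`. -/
def tangentialPart (c h : ℝ → Plane) : ℝ → ℝ := fun θ => ⟪Ds c h θ, unitTangent c θ⟫_ℝ

/-- The second order normal component `⟨D_s² h, n⟩`. -/
def normalPart (c h : ℝ → Plane) : ℝ → ℝ := fun θ => ⟪Ds c (Ds c h) θ, unitNormal c θ⟫_ℝ

/-- Integration over `[0, 2π]` with respect to arc length, `ds = |c'| dθ`. -/
def arcIntegral (c : ℝ → Plane) (f : ℝ → ℝ) : ℝ :=
  ∫ θ in (0 : ℝ)..(2 * Real.pi), f θ * speed c θ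

/-- The metric `G_c(h,k) = ∫ ⟨D_s h, v⟩⟨D_s k, v⟩ + ⟨D_s² h, n⟩⟨D_s² k, n⟩ ds`. -/
def metric (c h k : ℝ → Plane) : ℝ :=
  arcIntegral c fun θ =>
    tangentialPart c h θ * tangentialPart c k θ + normalPart c h θ * normalPart c k θ

theorem uniqueDiffOn_J : UniqueDiffOn ℝ J := uniqueDiffOn_Icc Real.two_pi_pos

theorem zero_mem_J : (0 : ℝ) ∈ J := Set.left_mem_Icc.2 Real.two_pi_pos.le

theorem ext_add (f g : J → Plane) : ext (f + g) = ext f + ext g := rfl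

theorem ext_smul (r : ℝ) (f : J → Plane) : ext (r • f) = r • ext f := rfl

theorem differentiableWithinAt_of_smooth {f : ℝ → Plane} (hf : ContDiffOn ℝ ∞ f J) :
    DifferentiableWithinAt ℝ f J 0 :=
  hf.differentiableOn (by simp) 0 zero_mem_J

/-- The closed subspace of all `h ∈ C^∞([0,2π], ℝ²)` with `h(0) = 0` and `h'(0) ∈ ℝ × {0}`. -/
def V : Submodule ℝ (J → Plane) where
  carrier := {h | ContDiffOn ℝ ∞ (ext h) J ∧ ext h 0 = 0 ∧ dθ (ext h) 0 1 = 0}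
  zero_mem' := by
    have h0 : ext (0 : J → Plane) = fun _ => 0 := rfl
    refine ⟨?_, ?_, ?_⟩
    · rw [h0]; exact contDiffOn_const
    · rw [h0]
    · simp [h0, dθ]
  add_mem' := by
    rintro f g ⟨hf, hf0, hf1⟩ ⟨hg, hg0, hg1⟩
    refine ⟨?_, ?_, ?_⟩
    · rw [ext_add]; exact hf.add hg
    · simp [ext_add, hf0, hg0]
    · have := derivWithin_add (differentiableWithinAt_of_smooth hf)
        (differentiableWithinAt_of_smooth hg)
      simp only [dθ] at hf1 hg1
      simp [ext_add, dθ, this, hf1, hg1]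
  smul_mem' := by
    rintro r f ⟨hf, hf0, hf1⟩
    refine ⟨?_, ?_, ?_⟩
    · rw [ext_smul]; exact hf.const_smul r
    · simp [ext_smul, hf0]
    · have := derivWithin_const_smul r (differentiableWithinAt_of_smooth hf)
      simp only [dθ] at hf1
      simp [ext_smul, dθ, this, hf1]

/-- An element of `V` as a map on the real line, see `ext`. -/
def toFun (h : V) : ℝ → Plane := ext h.1

/-- The manifold `Imm([0,2π], ℝ²)/Mot` of open curves modulo Euclidean motions, identified with
the section of all immersions `c` with `c(0) = 0` and turning angle `α(0) = 0`, that is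
`v(0) = (cos 0, sin 0) = (1, 0)`. It is an open subset of the Fréchet space `V`, so `V` is its
tangent space at every point. -/
def curvesModMot : Set V :=
  {c | (∀ θ ∈ J, dθ (toFun c) θ ≠ 0) ∧ unitTangent (toFun c) 0 = !₂[1, 0]}

/-- For every curve `c` of the manifold, `V` is the tangent space
`{h ∈ C^∞([0,2π], ℝ²) : h(0) = 0, ⟨D_s h(0), n(0)⟩ = 0}`. -/
theorem mem_V_iff {c : V} (hc : c ∈ curvesModMot) (h : J → Plane) :
    h ∈ V ↔ ContDiffOn ℝ ∞ (ext h) J ∧ ext h 0 = 0 ∧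
      ⟪Ds (toFun c) (ext h) 0, unitNormal (toFun c) 0⟫_ℝ = 0 := by
  have hs : speed (toFun c) 0 ≠ 0 := norm_ne_zero_iff.2 (hc.1 0 zero_mem_J)
  have hn : unitNormal (toFun c) 0 = !₂[0, 1] := by
    simp [unitNormal, hc.2, rot]
  have key : ⟪Ds (toFun c) (ext h) 0, unitNormal (toFun c) 0⟫_ℝ = 0 ↔
      dθ (ext h) 0 1 = 0 := by
    rw [hn]
    simp [Ds, PiLp.inner_apply, Fin.sum_univ_two, hs]
  rw [key]
  rfl

/-- Smooth curves `ℝ → V`: the map `(t, θ) ↦ γ(t)(θ)` is smooth on `ℝ × [0, 2π]`. -/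
def IsSmoothCurve (γ : ℝ → V) : Prop :=
  ContDiffOn ℝ ∞ (fun p : ℝ × ℝ => toFun (γ p.1) p.2) (Set.univ ×ˢ J)

/-- `Γ` is the Christoffel map of a Levi-Civita connection of the metric on `curvesModMot`, in the
global chart given by the inclusion into `V`: the covariant derivative is
`∇_X Y = dY(X) + Γ(X, Y)`. Smoothness of `(c, h, k) ↦ Γ_c(h, k)` means that smooth curves are mapped
to smooth curves. The values of `Γ_c` for `c` outside of the manifold are irrelevant. -/
structure IsLeviCivita (Γ : V → V →ₗ[ℝ] V →ₗ[ℝ] V) : Prop where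
  smooth : ∀ γ η ζ : ℝ → V, IsSmoothCurve γ → IsSmoothCurve η → IsSmoothCurve ζ →
    (∀ t, γ t ∈ curvesModMot) → IsSmoothCurve fun t => Γ (γ t) (η t) (ζ t)
  torsion_free : ∀ c ∈ curvesModMot, ∀ h k, Γ c h k = Γ c k h
  metric_compatible : ∀ c ∈ curvesModMot, ∀ m h k : V,
    HasDerivAt (fun t : ℝ => metric (toFun (c + t • m)) (toFun h) (toFun k))
      (metric (toFun c) (toFun (Γ c m h)) (toFun k)
        + metric (toFun c) (toFun h) (toFun (Γ c m k))) 0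

/-- The derivative `(D_{c,m} Γ)(h, k)` of `c ↦ Γ_c(h, k)` at `c` in the direction `m`. -/
def dΓ (Γ : V → V →ₗ[ℝ] V →ₗ[ℝ] V) (c m h k : V) : ℝ → Plane :=
  fun θ => deriv (fun t : ℝ => toFun (Γ (c + t • m) h k) θ) 0

/-- The curvature tensor `R(h,k)l = ∇_h ∇_k l - ∇_k ∇_h l - ∇_[h,k] l`, at the point `c`, of the
connection with Christoffel map `Γ`; in the chart, with constant vector fields `h, k, l`. -/
def curvatureTensor (Γ : V → V →ₗ[ℝ] V →ₗ[ℝ] V) (c h k l : V) : ℝ → Plane :=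
  dΓ Γ c h k l - dΓ Γ c k h l + toFun (Γ c h (Γ c k l)) - toFun (Γ c k (Γ c h l))

/-- The squared area `G(h,h) G(k,k) - G(h,k)²` of the parallelogram spanned by `h, k`. -/
def gram (c h k : V) : ℝ :=
  metric (toFun c) (toFun h) (toFun h) * metric (toFun c) (toFun k) (toFun k)
    - metric (toFun c) (toFun h) (toFun k) ^ 2

/-- The sectional curvature `G(R(h,k)k, h) / (G(h,h) G(k,k) - G(h,k)²)` of the plane spanned by
`h, k`. -/
def sectionalCurvature (Γ : V → V →ₗ[ℝ] V →ₗ[ℝ] V) (c h k : V) : ℝ :=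
  metric (toFun c) (curvatureTensor Γ c h k k) (toFun h) / gram c h k

end PlaneCurves

end

/-! Write ρ = |c'|, κ for the curvature of c, and T, N for the tangential and normal parts of a
tangent vector. Varying c gives δρ = ρT and δκ = N − 2κT (`hasDerivAt_norm_fst`,
`hasDerivAt_jetCurvature`). With w = κρ² this becomes δw = ρ²N, so at each θ the density ρ(T² + N²)
is the surface metric dρ²/ρ + dw²/ρ³. In r = 2√ρ it reads dr² + (8/r³)² dw², whose Gauss curvature
is −12/r² = −3/ρ. The metric G is the integral of these surface metrics over θ, without coupling
between different θ. Its connection and curvature are therefore computed pointwise, and since the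
squared area is ρ²(T_h N_k − T_k N_h)², the curvature integrand is −3(T_h N_k − T_k N_h)²ρ.

The pointwise picture is legitimate because the curves are open: h ↦ (T, N) is a bijection from `V`
onto pairs of smooth functions (`exists_curve_of_parts`, `eq_of_parts`), with no closing condition.
Hence Christoffel symbols exist as soon as their two parts are prescribed, and G is positive
definite.

The proof stays in the linear chart and treats T and N as functions of the jets (f', f''). Metric
compatibility and the curvature formula then become polynomial identities
(`hasDerivAt_metricDensity`, `metricDensity_curvature`). The derivative of Γ is never computed: its
two parts follow by differentiating the equations that define Γ (`IsLeviCivita.dΓ_spec`). -/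

open scoped ContDiff InnerProductSpace

noncomputable section

namespace PlaneCurves

/-! ### Calculus on the strip `ℝ × [0, 2π]` -/

section Strip

variable {E : Type*} [NormedAddCommGroup E] [NormedSpace ℝ E]

/-- The strip `ℝ × [0, 2π]`. -/
abbrev strip : Set (ℝ × ℝ) := Set.univ ×ˢ J

theorem mk_mem_strip {t θ : ℝ} (hθ : θ ∈ J) : (t, θ) ∈ strip := ⟨Set.mem_univ _, hθ⟩

theorem uniqueDiffOn_strip : UniqueDiffOn ℝ strip := uniqueDiffOn_univ.prod uniqueDiffOn_J

/-- The partial derivative in the direction of the interval. -/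
def partialθ (f : ℝ × ℝ → E) : ℝ × ℝ → E :=
  fun p => derivWithin (fun θ => f (p.1, θ)) J p.2

/-- The partial derivative in the time direction. -/
def partialt (f : ℝ × ℝ → E) : ℝ × ℝ → E := fun p => deriv (fun t => f (t, p.2)) p.1

variable {f : ℝ × ℝ → E}

theorem hasDerivWithinAt_fderivWithin_strip (hf : ContDiffOn ℝ ∞ f strip) (t : ℝ) {θ : ℝ}
    (hθ : θ ∈ J) :
    HasDerivWithinAt (fun x => f (t, x)) (fderivWithin ℝ f strip (t, θ) (0, 1)) J θ := by
  have h := (hf.differentiableOn (by simp) (t, θ) (mk_mem_strip hθ)).hasFDerivWithinAt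
  have hc : HasDerivWithinAt (fun x : ℝ => ((t, x) : ℝ × ℝ)) (0, 1) J θ :=
    (hasDerivWithinAt_const θ J t).prodMk (hasDerivWithinAt_id θ J)
  exact h.comp_hasDerivWithinAt θ hc fun x hx => mk_mem_strip hx

theorem hasDerivAt_fderivWithin_strip (hf : ContDiffOn ℝ ∞ f strip) (t : ℝ) {θ : ℝ}
    (hθ : θ ∈ J) :
    HasDerivAt (fun x => f (x, θ)) (fderivWithin ℝ f strip (t, θ) (1, 0)) t := by
  have h := (hf.differentiableOn (by simp) (t, θ) (mk_mem_strip hθ)).hasFDerivWithinAt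
  have hc : HasDerivWithinAt (fun x : ℝ => ((x, θ) : ℝ × ℝ)) (1, 0) Set.univ t :=
    (hasDerivWithinAt_id t _).prodMk (hasDerivWithinAt_const t _ θ)
  exact hasDerivWithinAt_univ.1 (h.comp_hasDerivWithinAt t hc fun x _ => mk_mem_strip hθ)

theorem partialθ_eq_fderivWithin (hf : ContDiffOn ℝ ∞ f strip) {p : ℝ × ℝ} (hp : p ∈ strip) :
    partialθ f p = fderivWithin ℝ f strip p (0, 1) :=
  (hasDerivWithinAt_fderivWithin_strip hf p.1 hp.2).derivWithin (uniqueDiffOn_J _ hp.2)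

theorem partialt_eq_fderivWithin (hf : ContDiffOn ℝ ∞ f strip) {p : ℝ × ℝ} (hp : p ∈ strip) :
    partialt f p = fderivWithin ℝ f strip p (1, 0) :=
  (hasDerivAt_fderivWithin_strip hf p.1 hp.2).deriv

theorem hasDerivWithinAt_partialθ (hf : ContDiffOn ℝ ∞ f strip) (t : ℝ) {θ : ℝ} (hθ : θ ∈ J) :
    HasDerivWithinAt (fun x => f (t, x)) (partialθ f (t, θ)) J θ := by
  rw [partialθ_eq_fderivWithin hf (mk_mem_strip hθ)]
  exact hasDerivWithinAt_fderivWithin_strip hf t hθ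

theorem hasDerivAt_partialt (hf : ContDiffOn ℝ ∞ f strip) (t : ℝ) {θ : ℝ} (hθ : θ ∈ J) :
    HasDerivAt (fun x => f (x, θ)) (partialt f (t, θ)) t := by
  rw [partialt_eq_fderivWithin hf (mk_mem_strip hθ)]
  exact hasDerivAt_fderivWithin_strip hf t hθ

theorem contDiffOn_fderivWithin_strip_apply (hf : ContDiffOn ℝ ∞ f strip) (v : ℝ × ℝ) :
    ContDiffOn ℝ ∞ (fun p => fderivWithin ℝ f strip p v) strip :=
  (hf.fderivWithin uniqueDiffOn_strip (by simp)).clm_apply contDiffOn_const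

theorem contDiffOn_partialθ (hf : ContDiffOn ℝ ∞ f strip) : ContDiffOn ℝ ∞ (partialθ f) strip :=
  (contDiffOn_fderivWithin_strip_apply hf (0, 1)).congr fun _ hp => partialθ_eq_fderivWithin hf hp

theorem contDiffOn_partialt (hf : ContDiffOn ℝ ∞ f strip) : ContDiffOn ℝ ∞ (partialt f) strip :=
  (contDiffOn_fderivWithin_strip_apply hf (1, 0)).congr fun _ hp => partialt_eq_fderivWithin hf hp

theorem fderivWithin_strip_congr {g : ℝ × ℝ → E} (h : Set.EqOn f g strip) {p : ℝ × ℝ}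
    (hp : p ∈ strip) : fderivWithin ℝ f strip p = fderivWithin ℝ g strip p :=
  fderivWithin_congr h (h hp)

/-- Symmetry of second derivatives within a set needs this at the boundary points θ = 0 and θ = 2π.
-/
theorem mem_closure_interior_strip {p : ℝ × ℝ} (hp : p ∈ strip) : p ∈ closure (interior strip) := by
  have h : closure (interior strip) = strip := by
    rw [interior_prod_eq, closure_prod_eq, interior_univ, closure_univ, interior_Icc,
      closure_Ioo Real.two_pi_pos.ne]
  rwa [h]

theorem two_le_infty : (2 : WithTop ℕ∞) ≤ ∞ :=
  WithTop.coe_le_coe.2 (le_top : (2 : ℕ∞) ≤ ⊤)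

/-- The partial derivatives commute. -/
theorem partialθ_partialt (hf : ContDiffOn ℝ ∞ f strip) {p : ℝ × ℝ} (hp : p ∈ strip) :
    partialθ (partialt f) p = partialt (partialθ f) p := by
  have hd : DifferentiableWithinAt ℝ (fderivWithin ℝ f strip) strip p :=
    (hf.fderivWithin (m := ∞) uniqueDiffOn_strip (by simp)).differentiableOn (by simp) p hp
  have key : ∀ v w, fderivWithin ℝ (fun q => fderivWithin ℝ f strip q v) strip p w =
      fderivWithin ℝ (fderivWithin ℝ f strip) strip p w v := fun v w => by
    have := (hd.hasFDerivWithinAt.clm_apply (hasFDerivWithinAt_const v p strip)).fderivWithin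
      (uniqueDiffOn_strip p hp)
    rw [this]; simp
  have hsymm := (hf p hp).isSymmSndFDerivWithinAt (by simpa using two_le_infty) uniqueDiffOn_strip
    (mem_closure_interior_strip hp) hp
  rw [partialθ_eq_fderivWithin (contDiffOn_partialt hf) hp,
    partialt_eq_fderivWithin (contDiffOn_partialθ hf) hp,
    fderivWithin_strip_congr (fun _ hq => partialt_eq_fderivWithin hf hq) hp,
    fderivWithin_strip_congr (fun _ hq => partialθ_eq_fderivWithin hf hq) hp, key, key]
  exact hsymm.eq _ _

theorem partialθ_congr {g : ℝ × ℝ → E} (h : Set.EqOn f g strip) :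
    Set.EqOn (partialθ f) (partialθ g) strip := fun _ hp =>
  derivWithin_congr (fun _ hx => h (mk_mem_strip hx)) (h hp)

/-- The projection of the plane onto the strip. -/
def clampStrip (p : ℝ × ℝ) : ℝ × ℝ := (p.1, Set.projIcc 0 (2 * Real.pi) Real.two_pi_pos.le p.2)

theorem clampStrip_mem (p : ℝ × ℝ) : clampStrip p ∈ strip := mk_mem_strip (Subtype.coe_prop _)

theorem clampStrip_of_mem {p : ℝ × ℝ} (hp : p ∈ strip) : clampStrip p = p := by
  obtain ⟨t, θ⟩ := p
  simp [clampStrip, Set.projIcc_of_mem _ hp.2]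

theorem continuous_clampStrip : Continuous clampStrip := by
  unfold clampStrip
  exact continuous_fst.prodMk (continuous_subtype_val.comp (continuous_projIcc.comp continuous_snd))

/-- Clamping gives a globally continuous integrand, to which theorems on parameter integrals over
all of ℝ apply; nothing changes on the strip. -/
theorem continuous_comp_clampStrip (hf : ContDiffOn ℝ ∞ f strip) :
    Continuous fun p => f (clampStrip p) :=
  hf.continuousOn.comp_continuous continuous_clampStrip clampStrip_mem

/-! ### Primitives and parameter integrals -/

/-- The primitive of a function on the strip in the direction of the interval. -/
def primitive (f : ℝ × ℝ → E) : ℝ × ℝ → E := fun p => ∫ s in (0 : ℝ)..p.2, f (p.1, s)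

theorem integral_clampStrip {t θ : ℝ} (hθ : θ ∈ J) :
    ∫ s in (0 : ℝ)..θ, f (clampStrip (t, s)) = primitive f (t, θ) := by
  refine intervalIntegral.integral_congr fun s hs => ?_
  rw [Set.uIcc_of_le hθ.1] at hs
  simp only
  rw [clampStrip_of_mem (mk_mem_strip ⟨hs.1, hs.2.trans hθ.2⟩)]

theorem hasDerivAt_integral_clampStrip (hf : ContDiffOn ℝ ∞ f strip) (t θ : ℝ) :
    HasDerivAt (fun t => ∫ s in (0 : ℝ)..θ, f (clampStrip (t, s)))
      (∫ s in (0 : ℝ)..θ, partialt f (clampStrip (t, s))) t := by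
  have hc := continuous_comp_clampStrip hf
  have hc' := continuous_comp_clampStrip (contDiffOn_partialt hf)
  -- The dominating function is a constant: a bound of ∂_t f on a compact rectangle around the given
  -- time.
  obtain ⟨C, hC⟩ := ((isCompact_Icc (a := t - 1) (b := t + 1)).prod
    (isCompact_uIcc (a := (0 : ℝ)) (b := θ))).exists_bound_of_continuousOn hc'.continuousOn
  refine (intervalIntegral.hasDerivAt_integral_of_dominated_loc_of_deriv_le
    (F := fun t s => f (clampStrip (t, s))) (F' := fun t s => partialt f (clampStrip (t, s)))
    (bound := fun _ => C) (Icc_mem_nhds (by linarith : t - 1 < t) (by linarith : t < t + 1))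
    (.of_forall fun x => ?_) ?_ ?_ ?_ ?_ ?_).2
  · exact (hc.comp (Continuous.prodMk_right x)).aestronglyMeasurable
  · exact (hc.comp (Continuous.prodMk_right t)).intervalIntegrable _ _
  · exact (hc'.comp (Continuous.prodMk_right t)).aestronglyMeasurable
  · exact .of_forall fun s hs x hx => hC (x, s) ⟨hx, Set.uIoc_subset_uIcc hs⟩
  · exact intervalIntegrable_const
  · exact .of_forall fun s _ x _ => hasDerivAt_partialt hf x (clampStrip_mem (x, s)).2

/-- Differentiation under the integral sign. -/
theorem hasDerivAt_integral_strip (hf : ContDiffOn ℝ ∞ f strip) (t : ℝ) :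
    HasDerivAt (fun t => ∫ s in (0 : ℝ)..(2 * Real.pi), f (t, s))
      (∫ s in (0 : ℝ)..(2 * Real.pi), partialt f (t, s)) t := by
  have h := hasDerivAt_integral_clampStrip hf t (2 * Real.pi)
  have hπ : 2 * Real.pi ∈ J := Set.right_mem_Icc.2 Real.two_pi_pos.le
  simp only [integral_clampStrip hπ] at h
  exact h

variable [CompleteSpace E]

/-- Both partial derivatives exist and are jointly continuous, which gives Fréchet
differentiability. -/
theorem hasFDerivAt_integral_clampStrip (hf : ContDiffOn ℝ ∞ f strip) (p : ℝ × ℝ) :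
    HasFDerivAt (fun p : ℝ × ℝ => ∫ s in (0 : ℝ)..p.2, f (clampStrip (p.1, s)))
      ((ContinuousLinearMap.toSpanSingleton ℝ
          (∫ s in (0 : ℝ)..p.2, partialt f (clampStrip (p.1, s)))).coprod
        (ContinuousLinearMap.toSpanSingleton ℝ (f (clampStrip p)))) p := by
  have hc := continuous_comp_clampStrip hf
  have hc' := continuous_comp_clampStrip (contDiffOn_partialt hf)
  have hspan : Continuous fun e : E => ContinuousLinearMap.toSpanSingleton ℝ e :=
    ContinuousLinearMap.toSpanSingletonCLE.continuous
  refine (hasStrictFDerivAt_uncurry_coprod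
    (f := fun t θ => ∫ s in (0 : ℝ)..θ, f (clampStrip (t, s)))
    (f₁ := fun t θ => ContinuousLinearMap.toSpanSingleton ℝ
      (∫ s in (0 : ℝ)..θ, partialt f (clampStrip (t, s))))
    (f₂ := fun t θ => ContinuousLinearMap.toSpanSingleton ℝ (f (clampStrip (t, θ))))
    (.of_forall fun q => ?_) (.of_forall fun q => ?_) ?_ ?_).hasFDerivAt
  · exact (hasDerivAt_integral_clampStrip hf q.1 q.2).hasFDerivAt
  · have h1 : Continuous fun s => f (clampStrip (q.1, s)) := hc.comp (Continuous.prodMk_right q.1)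
    exact (h1.integral_hasStrictDerivAt 0 q.2).hasDerivAt.hasFDerivAt
  · exact (hspan.comp (intervalIntegral.continuous_parametric_primitive_of_continuous
      (f := fun t s => partialt f (clampStrip (t, s))) hc')).continuousAt
  · exact (hspan.comp hc).continuousAt

theorem hasFDerivWithinAt_primitive (hf : ContDiffOn ℝ ∞ f strip) {p : ℝ × ℝ} (hp : p ∈ strip) :
    HasFDerivWithinAt (primitive f)
      ((ContinuousLinearMap.toSpanSingleton ℝ (primitive (partialt f) p)).coprod
        (ContinuousLinearMap.toSpanSingleton ℝ (f p))) strip p := by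
  have h := (hasFDerivAt_integral_clampStrip hf p).hasFDerivWithinAt (s := strip)
  rw [integral_clampStrip (f := partialt f) hp.2, clampStrip_of_mem hp] at h
  exact h.congr (fun q hq => (integral_clampStrip hq.2).symm) (integral_clampStrip hp.2).symm

/-- The derivative of the primitive of f consists of the primitive of ∂_t f and of f itself.
Induction on the order, over all smooth f at once, therefore gains one order at each step. -/
theorem contDiffOn_primitive (hf : ContDiffOn ℝ ∞ f strip) :
    ContDiffOn ℝ ∞ (primitive f) strip := by
  refine contDiffOn_infty.2 fun n => ?_
  induction n generalizing f with
  | zero =>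
    exact contDiffOn_zero.2 fun p hp => (hasFDerivWithinAt_primitive hf hp).continuousWithinAt
  | succ n ih =>
    push_cast
    refine (contDiffOn_succ_iff_hasFDerivWithinAt_of_uniqueDiffOn uniqueDiffOn_strip).2
      ⟨by simp,
        fun p => (ContinuousLinearMap.toSpanSingleton ℝ (primitive (partialt f) p)).coprod
          (ContinuousLinearMap.toSpanSingleton ℝ (f p)),
        ?_, fun p hp => hasFDerivWithinAt_primitive hf hp⟩
    refine contDiffOn_clm_apply.2 fun y => ?_
    simp only [ContinuousLinearMap.coprod_apply, ContinuousLinearMap.toSpanSingleton_apply]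
    exact ((ih (contDiffOn_partialt hf)).const_smul y.1).add
      ((hf.of_le (by exact_mod_cast le_top)).const_smul y.2)

theorem partialθ_primitive (hf : ContDiffOn ℝ ∞ f strip) {p : ℝ × ℝ} (hp : p ∈ strip) :
    partialθ (primitive f) p = f p := by
  rw [partialθ_eq_fderivWithin (contDiffOn_primitive hf) hp,
    (hasFDerivWithinAt_primitive hf hp).fderivWithin (uniqueDiffOn_strip p hp)]
  simp

end Strip

/-! ### The metric in terms of jets -/

section Jets

/-- The values `(f', f'')` of the first two derivatives of a curve at a point. -/
abbrev Jet : Type := Plane × Plane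

/-- The oriented area of the parallelogram spanned by two vectors. -/
def cross (p w : Plane) : ℝ := p 0 * w 1 - p 1 * w 0

theorem inner_eq (p w : Plane) : ⟪p, w⟫_ℝ = p 0 * w 0 + p 1 * w 1 := by
  simp [PiLp.inner_apply, Fin.sum_univ_two, mul_comm]

theorem norm_sq_eq (p : Plane) : ‖p‖ ^ 2 = p 0 ^ 2 + p 1 ^ 2 := by
  rw [← real_inner_self_eq_norm_sq, inner_eq]; ring

theorem inner_rot (w p : Plane) : ⟪w, rot p⟫_ℝ = cross p w := by
  simp [inner_eq, rot, cross]; ring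

/-- The tangential part `⟨D_s h, v⟩` in terms of the jets `x` of `c` and `y` of `h`. -/
def jetTangential (x y : Jet) : ℝ := ⟪x.1, y.1⟫_ℝ / ‖x.1‖ ^ 2

/-- The curvature of `c` in terms of its jet. -/
def jetCurvature (x : Jet) : ℝ := cross x.1 x.2 / ‖x.1‖ ^ 3

/-- The normal part `⟨D_s² h, n⟩` in terms of the jets `x` of `c` and `y` of `h`. -/
def jetNormal (x y : Jet) : ℝ :=
  (cross x.1 y.2 + cross y.1 x.2) / ‖x.1‖ ^ 3 - jetCurvature x * jetTangential x y

/-- The normalized inner product `⟨D_s h, D_s k⟩` in terms of jets. -/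
def jetInner (x y z : Jet) : ℝ := ⟪y.1, z.1⟫_ℝ / ‖x.1‖ ^ 2

/-- The normalized second derivative of the quadratic form `c' × c''`. -/
def jetCross (x y z : Jet) : ℝ := (cross y.1 z.2 + cross z.1 y.2) / ‖x.1‖ ^ 3

/-- The tangential part of the Christoffel symbol. -/
def christoffelTangential (x y z : Jet) : ℝ :=
  jetInner x y z - 3 / 2 * (jetTangential x y * jetTangential x z)
    + 3 / 2 * (jetNormal x y * jetNormal x z)

/-- The normal part of the Christoffel symbol. -/
def christoffelNormal (x y z : Jet) : ℝ :=
  jetCross x y z - 5 / 2 * (jetTangential x y * jetNormal x z + jetTangential x z * jetNormal x y)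
    + jetCurvature x * (jetTangential x y * jetTangential x z - jetInner x y z)

theorem jetInner_comm (x y z : Jet) : jetInner x y z = jetInner x z y := by
  simp only [jetInner, real_inner_comm]

theorem jetCross_comm (x y z : Jet) : jetCross x y z = jetCross x z y := by
  simp only [jetCross, add_comm]

theorem jetTangential_add (x y z : Jet) :
    jetTangential x (y + z) = jetTangential x y + jetTangential x z := by
  simp [jetTangential, inner_add_right, add_div]

theorem jetTangential_smul (x : Jet) (r : ℝ) (y : Jet) :
    jetTangential x (r • y) = r * jetTangential x y := by
  simp [jetTangential, inner_smul_right, mul_div_assoc]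

theorem jetNormal_add (x y z : Jet) : jetNormal x (y + z) = jetNormal x y + jetNormal x z := by
  simp [jetNormal, jetTangential_add, cross]; ring

theorem jetNormal_smul (x : Jet) (r : ℝ) (y : Jet) :
    jetNormal x (r • y) = r * jetNormal x y := by
  simp [jetNormal, jetTangential_smul, cross]; ring

theorem jetTangential_sub (x y z : Jet) :
    jetTangential x (y - z) = jetTangential x y - jetTangential x z := by
  rw [sub_eq_add_neg, ← neg_one_smul ℝ z, jetTangential_add, jetTangential_smul]; ring

theorem jetNormal_sub (x y z : Jet) : jetNormal x (y - z) = jetNormal x y - jetNormal x z := by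
  rw [sub_eq_add_neg, ← neg_one_smul ℝ z, jetNormal_add, jetNormal_smul]; ring

theorem jetInner_add (x y z w : Jet) : jetInner x (y + z) w = jetInner x y w + jetInner x z w := by
  simp [jetInner, inner_add_left, add_div]

theorem jetInner_smul (x : Jet) (r : ℝ) (y z : Jet) :
    jetInner x (r • y) z = r * jetInner x y z := by
  simp [jetInner, inner_smul_left, mul_div_assoc]

theorem jetCross_add (x y z w : Jet) : jetCross x (y + z) w = jetCross x y w + jetCross x z w := by
  simp [jetCross, cross]; ring

theorem jetCross_smul (x : Jet) (r : ℝ) (y z : Jet) :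
    jetCross x (r • y) z = r * jetCross x y z := by
  simp [jetCross, cross]; ring

theorem christoffelTangential_comm (x y z : Jet) :
    christoffelTangential x y z = christoffelTangential x z y := by
  simp only [christoffelTangential, jetInner_comm x y z]; ring

theorem christoffelNormal_comm (x y z : Jet) :
    christoffelNormal x y z = christoffelNormal x z y := by
  simp only [christoffelNormal, jetInner_comm x y z, jetCross_comm x y z]; ring

theorem christoffelTangential_add (x y z w : Jet) :
    christoffelTangential x (y + z) w =
      christoffelTangential x y w + christoffelTangential x z w := by
  simp only [christoffelTangential, jetInner_add, jetTangential_add, jetNormal_add]; ring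

theorem christoffelNormal_add (x y z w : Jet) :
    christoffelNormal x (y + z) w = christoffelNormal x y w + christoffelNormal x z w := by
  simp only [christoffelNormal, jetInner_add, jetTangential_add, jetNormal_add, jetCross_add]; ring

theorem christoffelTangential_smul (x : Jet) (r : ℝ) (y z : Jet) :
    christoffelTangential x (r • y) z = r * christoffelTangential x y z := by
  simp only [christoffelTangential, jetInner_smul, jetTangential_smul, jetNormal_smul]; ring

theorem christoffelNormal_smul (x : Jet) (r : ℝ) (y z : Jet) :
    christoffelNormal x (r • y) z = r * christoffelNormal x y z := by
  simp only [christoffelNormal, jetInner_smul, jetTangential_smul, jetNormal_smul, jetCross_smul]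
  ring

/-- The derivative of the tangential part of `y` in the direction `m`. -/
def jetTangentialDeriv (x m y : Jet) : ℝ :=
  jetInner x m y - 2 * (jetTangential x m * jetTangential x y)

/-- The derivative of the normal part of `y` in the direction `m`. -/
def jetNormalDeriv (x m y : Jet) : ℝ :=
  jetCross x m y - 3 * (jetTangential x m * jetNormal x y) - jetTangential x y * jetNormal x m
    + jetCurvature x * (jetTangential x m * jetTangential x y - jetInner x m y)

/-! ### Derivatives along a path of jets -/

theorem hasDerivWithinAt_norm {F : Type*} [NormedAddCommGroup F] [InnerProductSpace ℝ F]
    {f : ℝ → F} {f' : F} {s : Set ℝ} {t : ℝ} (hf : HasDerivWithinAt f f' s t) (h0 : f t ≠ 0) :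
    HasDerivWithinAt (fun t => ‖f t‖) (⟪f t, f'⟫_ℝ / ‖f t‖) s t := by
  have hn : ‖f t‖ ≠ 0 := norm_ne_zero_iff.2 h0
  have h := (hf.norm_sq).sqrt (pow_ne_zero 2 hn)
  simp only [Real.sqrt_sq (norm_nonneg _)] at h
  convert h using 1
  field_simp

variable {X Y : ℝ → Jet} {m y' : Jet} {t : ℝ}

theorem hasDerivAt_jet_fst (hX : HasDerivAt X m t) : HasDerivAt (fun t => (X t).1) m.1 t :=
  (ContinuousLinearMap.fst ℝ Plane Plane).hasFDerivAt.comp_hasDerivAt t hX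

theorem hasDerivAt_jet_snd (hX : HasDerivAt X m t) : HasDerivAt (fun t => (X t).2) m.2 t :=
  (ContinuousLinearMap.snd ℝ Plane Plane).hasFDerivAt.comp_hasDerivAt t hX

theorem hasDerivAt_norm_fst (hX : HasDerivAt X m t) (h0 : (X t).1 ≠ 0) :
    HasDerivAt (fun t => ‖(X t).1‖) (jetTangential (X t) m * ‖(X t).1‖) t := by
  have hn : ‖(X t).1‖ ≠ 0 := norm_ne_zero_iff.2 h0
  have h := (hasDerivWithinAt_norm ((hasDerivAt_jet_fst hX).hasDerivWithinAt (s := Set.univ))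
    h0).hasDerivAt Filter.univ_mem
  refine h.congr_deriv ?_
  rw [jetTangential]
  field_simp

theorem hasDerivAt_cross {P W : ℝ → Plane} {p' w' : Plane} (hP : HasDerivAt P p' t)
    (hW : HasDerivAt W w' t) :
    HasDerivAt (fun t => cross (P t) (W t)) (cross p' (W t) + cross (P t) w') t := by
  have hP0 (i : Fin 2) : HasDerivAt (fun t => P t i) (p' i) t :=
    (EuclideanSpace.proj (𝕜 := ℝ) i).hasFDerivAt.comp_hasDerivAt t hP
  have hW0 (i : Fin 2) : HasDerivAt (fun t => W t i) (w' i) t :=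
    (EuclideanSpace.proj (𝕜 := ℝ) i).hasFDerivAt.comp_hasDerivAt t hW
  refine (((hP0 0).mul (hW0 1)).sub ((hP0 1).mul (hW0 0))).congr_deriv ?_
  simp only [cross]
  ring

theorem hasDerivAt_jetTangential (hX : HasDerivAt X m t) (hY : HasDerivAt Y y' t)
    (h0 : (X t).1 ≠ 0) :
    HasDerivAt (fun t => jetTangential (X t) (Y t))
      (jetTangentialDeriv (X t) m (Y t) + jetTangential (X t) y') t := by
  have hn : ‖(X t).1‖ ≠ 0 := norm_ne_zero_iff.2 h0
  refine HasDerivAt.congr_deriv (((hasDerivAt_jet_fst hX).inner ℝ (hasDerivAt_jet_fst hY)).div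
    ((hasDerivAt_norm_fst hX h0).pow 2) (pow_ne_zero 2 hn)) ?_
  simp only [jetTangentialDeriv, jetTangential, jetInner]
  field_simp
  ring

theorem hasDerivAt_jetInner (hX : HasDerivAt X m t) (h0 : (X t).1 ≠ 0) (y z : Jet) :
    HasDerivAt (fun t => jetInner (X t) y z) (-2 * (jetTangential (X t) m * jetInner (X t) y z))
      t := by
  have hn : ‖(X t).1‖ ≠ 0 := norm_ne_zero_iff.2 h0
  refine HasDerivAt.congr_deriv ((hasDerivAt_const t ⟪y.1, z.1⟫_ℝ).div
    ((hasDerivAt_norm_fst hX h0).pow 2) (pow_ne_zero 2 hn)) ?_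
  simp only [jetInner]
  field_simp
  ring

theorem hasDerivAt_jetCross (hX : HasDerivAt X m t) (h0 : (X t).1 ≠ 0) (y z : Jet) :
    HasDerivAt (fun t => jetCross (X t) y z) (-3 * (jetTangential (X t) m * jetCross (X t) y z))
      t := by
  have hn : ‖(X t).1‖ ≠ 0 := norm_ne_zero_iff.2 h0
  refine HasDerivAt.congr_deriv ((hasDerivAt_const t (cross y.1 z.2 + cross z.1 y.2)).div
    ((hasDerivAt_norm_fst hX h0).pow 3) (pow_ne_zero 3 hn)) ?_
  simp only [jetCross]
  field_simp
  ring

theorem hasDerivAt_jetCurvature (hX : HasDerivAt X m t) (h0 : (X t).1 ≠ 0) :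
    HasDerivAt (fun t => jetCurvature (X t))
      (jetNormal (X t) m - 2 * (jetTangential (X t) m * jetCurvature (X t))) t := by
  have hn : ‖(X t).1‖ ≠ 0 := norm_ne_zero_iff.2 h0
  refine HasDerivAt.congr_deriv ((hasDerivAt_cross (hasDerivAt_jet_fst hX)
    (hasDerivAt_jet_snd hX)).div ((hasDerivAt_norm_fst hX h0).pow 3) (pow_ne_zero 3 hn)) ?_
  simp only [jetCurvature, jetNormal]
  field_simp
  ring

theorem hasDerivAt_jetNormal (hX : HasDerivAt X m t) (hY : HasDerivAt Y y' t)
    (h0 : (X t).1 ≠ 0) :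
    HasDerivAt (fun t => jetNormal (X t) (Y t))
      (jetNormalDeriv (X t) m (Y t) + jetNormal (X t) y') t := by
  have hn : ‖(X t).1‖ ≠ 0 := norm_ne_zero_iff.2 h0
  refine HasDerivAt.congr_deriv ((((hasDerivAt_cross (hasDerivAt_jet_fst hX)
    (hasDerivAt_jet_snd hY)).add
    (hasDerivAt_cross (hasDerivAt_jet_fst hY) (hasDerivAt_jet_snd hX))).div
    ((hasDerivAt_norm_fst hX h0).pow 3) (pow_ne_zero 3 hn)).sub
    ((hasDerivAt_jetCurvature hX h0).mul (hasDerivAt_jetTangential hX hY h0))) ?_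
  simp only [jetNormalDeriv, jetTangentialDeriv, jetNormal, jetCross, jetCurvature, Pi.add_apply,
    Pi.pow_apply]
  field_simp
  ring

theorem hasDerivAt_jetTangential_const (hX : HasDerivAt X m t) (h0 : (X t).1 ≠ 0) (y : Jet) :
    HasDerivAt (fun t => jetTangential (X t) y) (jetTangentialDeriv (X t) m y) t := by
  refine HasDerivAt.congr_deriv (hasDerivAt_jetTangential hX (hasDerivAt_const t y) h0) ?_
  simp [jetTangential]

theorem hasDerivAt_jetNormal_const (hX : HasDerivAt X m t) (h0 : (X t).1 ≠ 0) (y : Jet) :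
    HasDerivAt (fun t => jetNormal (X t) y) (jetNormalDeriv (X t) m y) t := by
  refine HasDerivAt.congr_deriv (hasDerivAt_jetNormal hX (hasDerivAt_const t y) h0) ?_
  simp [jetNormal, jetTangential, cross]

/-- The derivative of `christoffelTangential · y z` in the direction `m`. -/
def christoffelTangentialDeriv (x m y z : Jet) : ℝ :=
  -2 * (jetTangential x m * jetInner x y z)
    - 3 / 2 * (jetTangentialDeriv x m y * jetTangential x z
      + jetTangential x y * jetTangentialDeriv x m z)
    + 3 / 2 * (jetNormalDeriv x m y * jetNormal x z + jetNormal x y * jetNormalDeriv x m z)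

/-- The derivative of `christoffelNormal · y z` in the direction `m`. -/
def christoffelNormalDeriv (x m y z : Jet) : ℝ :=
  -3 * (jetTangential x m * jetCross x y z)
    - 5 / 2 * (jetTangentialDeriv x m y * jetNormal x z + jetTangential x y * jetNormalDeriv x m z
      + (jetTangentialDeriv x m z * jetNormal x y + jetTangential x z * jetNormalDeriv x m y))
    + ((jetNormal x m - 2 * (jetTangential x m * jetCurvature x))
        * (jetTangential x y * jetTangential x z - jetInner x y z)
      + jetCurvature x * (jetTangentialDeriv x m y * jetTangential x z
        + jetTangential x y * jetTangentialDeriv x m z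
        - -2 * (jetTangential x m * jetInner x y z)))

theorem hasDerivAt_christoffelTangential (hX : HasDerivAt X m t) (h0 : (X t).1 ≠ 0) (y z : Jet) :
    HasDerivAt (fun t => christoffelTangential (X t) y z)
      (christoffelTangentialDeriv (X t) m y z) t :=
  ((hasDerivAt_jetInner hX h0 y z).sub
    (((hasDerivAt_jetTangential_const hX h0 y).mul
      (hasDerivAt_jetTangential_const hX h0 z)).const_mul _)).add
    (((hasDerivAt_jetNormal_const hX h0 y).mul (hasDerivAt_jetNormal_const hX h0 z)).const_mul _)

theorem hasDerivAt_christoffelNormal (hX : HasDerivAt X m t) (h0 : (X t).1 ≠ 0) (y z : Jet) :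
    HasDerivAt (fun t => christoffelNormal (X t) y z) (christoffelNormalDeriv (X t) m y z) t :=
  ((hasDerivAt_jetCross hX h0 y z).sub
    ((((hasDerivAt_jetTangential_const hX h0 y).mul (hasDerivAt_jetNormal_const hX h0 z)).add
      ((hasDerivAt_jetTangential_const hX h0 z).mul
        (hasDerivAt_jetNormal_const hX h0 y))).const_mul _)).add
    ((hasDerivAt_jetCurvature hX h0).mul
      (((hasDerivAt_jetTangential_const hX h0 y).mul
        (hasDerivAt_jetTangential_const hX h0 z)).sub (hasDerivAt_jetInner hX h0 y z)))

/-! ### Compatibility and curvature at a fixed parameter -/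

/-- The integrand of the metric with respect to the parameter, in terms of jets. -/
def metricDensity (x y z : Jet) : ℝ :=
  (jetTangential x y * jetTangential x z + jetNormal x y * jetNormal x z) * ‖x.1‖

/-- The density sees `u` and `w` only through their two parts, so prescribing these suffices. What
remains is an identity between polynomials in T, N, κ, the norm, `jetInner` and `jetCross`. -/
theorem hasDerivAt_metricDensity (hX : HasDerivAt X m t) (h0 : (X t).1 ≠ 0) (y z : Jet)
    {u w : Jet} (huT : jetTangential (X t) u = christoffelTangential (X t) m y)
    (huN : jetNormal (X t) u = christoffelNormal (X t) m y)
    (hwT : jetTangential (X t) w = christoffelTangential (X t) m z)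
    (hwN : jetNormal (X t) w = christoffelNormal (X t) m z) :
    HasDerivAt (fun t => metricDensity (X t) y z)
      (metricDensity (X t) u z + metricDensity (X t) y w) t := by
  refine HasDerivAt.congr_deriv ((((hasDerivAt_jetTangential_const hX h0 y).mul
    (hasDerivAt_jetTangential_const hX h0 z)).add ((hasDerivAt_jetNormal_const hX h0 y).mul
    (hasDerivAt_jetNormal_const hX h0 z))).mul (hasDerivAt_norm_fst hX h0)) ?_
  simp only [metricDensity, huT, huN, hwT, hwN, christoffelTangential, christoffelNormal,
    jetTangentialDeriv, jetNormalDeriv, Pi.add_apply, Pi.mul_apply]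
  ring

/-- The curvature tensor of the pointwise connection: `u` and `w` are the Christoffel symbols of
`(k, k)` and `(h, k)`, and `u'` and `w'` their derivatives in the directions `h` and `k`. -/
theorem metricDensity_curvature {x h k u w u' w' u'' w'' : Jet}
    (huT : jetTangential x u = christoffelTangential x k k)
    (huN : jetNormal x u = christoffelNormal x k k)
    (hwT : jetTangential x w = christoffelTangential x h k)
    (hwN : jetNormal x w = christoffelNormal x h k)
    (huT' : jetTangentialDeriv x h u + jetTangential x u' = christoffelTangentialDeriv x h k k)
    (huN' : jetNormalDeriv x h u + jetNormal x u' = christoffelNormalDeriv x h k k)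
    (hwT' : jetTangentialDeriv x k w + jetTangential x w' = christoffelTangentialDeriv x k h k)
    (hwN' : jetNormalDeriv x k w + jetNormal x w' = christoffelNormalDeriv x k h k)
    (huT'' : jetTangential x u'' = christoffelTangential x h u)
    (huN'' : jetNormal x u'' = christoffelNormal x h u)
    (hwT'' : jetTangential x w'' = christoffelTangential x k w)
    (hwN'' : jetNormal x w'' = christoffelNormal x k w) :
    metricDensity x (u' - w' + u'' - w'') h =
      -3 * ((jetTangential x h * jetNormal x k - jetTangential x k * jetNormal x h) ^ 2
        * ‖x.1‖) := by
  -- The differentiated equations are solved for the parts of `u'` and `w'`; after substitution both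
  -- sides are polynomials in the same quantities.
  rw [← eq_sub_iff_add_eq'] at huT' huN' hwT' hwN'
  simp only [metricDensity, jetTangential_add, jetTangential_sub, jetNormal_add, jetNormal_sub,
    huT', huN', hwT', hwN', huT'', huN'', hwT'', hwN'']
  simp only [christoffelTangentialDeriv, christoffelNormalDeriv, christoffelTangential,
    christoffelNormal, jetTangentialDeriv, jetNormalDeriv, huT, huN, hwT, hwN,
    jetInner_comm x k h, jetCross_comm x k h]
  ring

end Jets

/-! ### Jets of curves -/

/-- The jet of a curve at a parameter. -/
def jet (f : ℝ → Plane) (θ : ℝ) : Jet := (dθ f θ, dθ (dθ f) θ)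

theorem contDiffOn_dθ {f : ℝ → Plane} (hf : ContDiffOn ℝ ∞ f J) : ContDiffOn ℝ ∞ (dθ f) J :=
  hf.derivWithin uniqueDiffOn_J (by simp)

theorem hasDerivWithinAt_dθ {f : ℝ → Plane} (hf : ContDiffOn ℝ ∞ f J) {θ : ℝ} (hθ : θ ∈ J) :
    HasDerivWithinAt f (dθ f θ) J θ :=
  (hf.differentiableOn (by simp) θ hθ).hasDerivWithinAt

theorem dθ_eq {f : ℝ → Plane} {f' : Plane} {θ : ℝ} (hθ : θ ∈ J)
    (hf : HasDerivWithinAt f f' J θ) : dθ f θ = f' :=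
  hf.derivWithin (uniqueDiffOn_J θ hθ)

theorem dθ_congr {f g : ℝ → Plane} (h : Set.EqOn f g J) : Set.EqOn (dθ f) (dθ g) J :=
  fun _ hθ => derivWithin_congr h (h hθ)

theorem dθ_add {f g : ℝ → Plane} (hf : ContDiffOn ℝ ∞ f J) (hg : ContDiffOn ℝ ∞ g J) :
    Set.EqOn (dθ (f + g)) (dθ f + dθ g) J := fun _ hθ =>
  dθ_eq hθ ((hasDerivWithinAt_dθ hf hθ).add (hasDerivWithinAt_dθ hg hθ))

theorem dθ_smul (r : ℝ) {f : ℝ → Plane} (hf : ContDiffOn ℝ ∞ f J) :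
    Set.EqOn (dθ (r • f)) (r • dθ f) J := fun _ hθ =>
  dθ_eq hθ ((hasDerivWithinAt_dθ hf hθ).const_smul r)

theorem jet_add {f g : ℝ → Plane} (hf : ContDiffOn ℝ ∞ f J) (hg : ContDiffOn ℝ ∞ g J) {θ : ℝ}
    (hθ : θ ∈ J) : jet (f + g) θ = jet f θ + jet g θ :=
  Prod.ext (dθ_add hf hg hθ) ((dθ_congr (dθ_add hf hg) hθ).trans
    (dθ_add (contDiffOn_dθ hf) (contDiffOn_dθ hg) hθ))

theorem jet_smul (r : ℝ) {f : ℝ → Plane} (hf : ContDiffOn ℝ ∞ f J) {θ : ℝ}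
    (hθ : θ ∈ J) : jet (r • f) θ = r • jet f θ :=
  Prod.ext (dθ_smul r hf hθ) ((dθ_congr (dθ_smul r hf) hθ).trans
    (dθ_smul r (contDiffOn_dθ hf) hθ))

theorem jet_sub {f g : ℝ → Plane} (hf : ContDiffOn ℝ ∞ f J) (hg : ContDiffOn ℝ ∞ g J) {θ : ℝ}
    (hθ : θ ∈ J) : jet (f - g) θ = jet f θ - jet g θ := by
  have h : f - g = f + (-1 : ℝ) • g := by module
  rw [h, jet_add (g := (-1 : ℝ) • g) hf (hg.const_smul (-1 : ℝ)) hθ, jet_smul _ hg hθ]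
  module

theorem tangentialPart_eq_jetTangential (c h : ℝ → Plane) (θ : ℝ) :
    tangentialPart c h θ = jetTangential (jet c θ) (jet h θ) := by
  simp only [tangentialPart, unitTangent, Ds, speed, inner_smul_left, inner_smul_right,
    jetTangential, jet, real_inner_comm (dθ h θ)]
  simp only [conj_trivial]
  rw [div_eq_mul_inv, ← inv_pow]
  ring

/-- `jetNormal` is written with the first variation c' × h'' + h' × c'' of c' × c''. It agrees with
⟨D_s² h, n⟩ by the planar identity |c'|² (h' × c'') = ⟨c', h'⟩ (c' × c'') − ⟨c', c''⟩ (c' × h'). -/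
theorem normalPart_eq_jetNormal {c h : ℝ → Plane} (hc : ContDiffOn ℝ ∞ c J)
    (hh : ContDiffOn ℝ ∞ h J) {θ : ℝ} (hθ : θ ∈ J) (h0 : dθ c θ ≠ 0) :
    normalPart c h θ = jetNormal (jet c θ) (jet h θ) := by
  have hn : ‖dθ c θ‖ ≠ 0 := norm_ne_zero_iff.2 h0
  have hρ := hasDerivWithinAt_norm (hasDerivWithinAt_dθ (contDiffOn_dθ hc) hθ) h0
  have hd : dθ (Ds c h) θ = _ :=
    dθ_eq hθ ((hρ.inv hn).smul (hasDerivWithinAt_dθ (contDiffOn_dθ hh) hθ))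
  have h2 := norm_sq_eq (dθ c θ)
  rw [normalPart, Ds, hd, unitNormal, inner_rot]
  simp only [cross, unitTangent, Ds, speed, jetNormal, jetTangential, jetCurvature, jet, inner_eq,
    PiLp.smul_apply, PiLp.add_apply, smul_eq_mul, Pi.inv_apply]
  field_simp
  rw [h2]
  ring

theorem metric_eq_integral {c h k : ℝ → Plane} (hc : ContDiffOn ℝ ∞ c J)
    (hh : ContDiffOn ℝ ∞ h J) (hk : ContDiffOn ℝ ∞ k J) (h0 : ∀ θ ∈ J, dθ c θ ≠ 0) :
    metric c h k =
      ∫ θ in (0 : ℝ)..(2 * Real.pi), metricDensity (jet c θ) (jet h θ) (jet k θ) := by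
  refine intervalIntegral.integral_congr fun θ hθ => ?_
  rw [Set.uIcc_of_le Real.two_pi_pos.le] at hθ
  simp only [tangentialPart_eq_jetTangential, normalPart_eq_jetNormal hc hh hθ (h0 θ hθ),
    normalPart_eq_jetNormal hc hk hθ (h0 θ hθ)]
  rfl

/-! ### Smooth dependence of the jet expressions -/

section Smoothness

variable {E : Type*} [NormedAddCommGroup E] [NormedSpace ℝ E] {s : Set E} {n : WithTop ℕ∞}
  {X Y Z : E → Jet}

theorem contDiffOn_cross {P W : E → Plane} (hP : ContDiffOn ℝ n P s) (hW : ContDiffOn ℝ n W s) :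
    ContDiffOn ℝ n (fun p => cross (P p) (W p)) s := by
  have hP' := contDiffOn_euclidean.1 hP
  have hW' := contDiffOn_euclidean.1 hW
  exact ((hP' 0).mul (hW' 1)).sub ((hP' 1).mul (hW' 0))

theorem contDiffOn_norm_fst (hX : ContDiffOn ℝ n X s) (h0 : ∀ p ∈ s, (X p).1 ≠ 0) :
    ContDiffOn ℝ n (fun p => ‖(X p).1‖) s :=
  hX.fst.norm ℝ h0

theorem contDiffOn_jetInner (hX : ContDiffOn ℝ n X s) (hY : ContDiffOn ℝ n Y s)
    (hZ : ContDiffOn ℝ n Z s) (h0 : ∀ p ∈ s, (X p).1 ≠ 0) :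
    ContDiffOn ℝ n (fun p => jetInner (X p) (Y p) (Z p)) s :=
  (hY.fst.inner ℝ hZ.fst).div ((contDiffOn_norm_fst hX h0).pow 2)
    fun p hp => pow_ne_zero 2 (norm_ne_zero_iff.2 (h0 p hp))

theorem contDiffOn_jetTangential (hX : ContDiffOn ℝ n X s) (hY : ContDiffOn ℝ n Y s)
    (h0 : ∀ p ∈ s, (X p).1 ≠ 0) :
    ContDiffOn ℝ n (fun p => jetTangential (X p) (Y p)) s :=
  contDiffOn_jetInner hX hX hY h0

theorem contDiffOn_jetCross (hX : ContDiffOn ℝ n X s) (hY : ContDiffOn ℝ n Y s)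
    (hZ : ContDiffOn ℝ n Z s) (h0 : ∀ p ∈ s, (X p).1 ≠ 0) :
    ContDiffOn ℝ n (fun p => jetCross (X p) (Y p) (Z p)) s :=
  ((contDiffOn_cross hY.fst hZ.snd).add (contDiffOn_cross hZ.fst hY.snd)).div
    ((contDiffOn_norm_fst hX h0).pow 3) fun p hp => pow_ne_zero 3 (norm_ne_zero_iff.2 (h0 p hp))

theorem contDiffOn_jetCurvature (hX : ContDiffOn ℝ n X s) (h0 : ∀ p ∈ s, (X p).1 ≠ 0) :
    ContDiffOn ℝ n (fun p => jetCurvature (X p)) s :=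
  (contDiffOn_cross hX.fst hX.snd).div
    ((contDiffOn_norm_fst hX h0).pow 3) fun p hp => pow_ne_zero 3 (norm_ne_zero_iff.2 (h0 p hp))

theorem contDiffOn_jetNormal (hX : ContDiffOn ℝ n X s) (hY : ContDiffOn ℝ n Y s)
    (h0 : ∀ p ∈ s, (X p).1 ≠ 0) :
    ContDiffOn ℝ n (fun p => jetNormal (X p) (Y p)) s :=
  (contDiffOn_jetCross hX hX hY h0).sub
    ((contDiffOn_jetCurvature hX h0).mul (contDiffOn_jetTangential hX hY h0))

theorem contDiffOn_christoffelTangential (hX : ContDiffOn ℝ n X s) (hY : ContDiffOn ℝ n Y s)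
    (hZ : ContDiffOn ℝ n Z s) (h0 : ∀ p ∈ s, (X p).1 ≠ 0) :
    ContDiffOn ℝ n (fun p => christoffelTangential (X p) (Y p) (Z p)) s :=
  ((contDiffOn_jetInner hX hY hZ h0).sub
    (contDiffOn_const.mul ((contDiffOn_jetTangential hX hY h0).mul
      (contDiffOn_jetTangential hX hZ h0)))).add
    (contDiffOn_const.mul ((contDiffOn_jetNormal hX hY h0).mul (contDiffOn_jetNormal hX hZ h0)))

theorem contDiffOn_christoffelNormal (hX : ContDiffOn ℝ n X s) (hY : ContDiffOn ℝ n Y s)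
    (hZ : ContDiffOn ℝ n Z s) (h0 : ∀ p ∈ s, (X p).1 ≠ 0) :
    ContDiffOn ℝ n (fun p => christoffelNormal (X p) (Y p) (Z p)) s :=
  ((contDiffOn_jetCross hX hY hZ h0).sub
    (contDiffOn_const.mul (((contDiffOn_jetTangential hX hY h0).mul
      (contDiffOn_jetNormal hX hZ h0)).add ((contDiffOn_jetTangential hX hZ h0).mul
      (contDiffOn_jetNormal hX hY h0))))).add
    ((contDiffOn_jetCurvature hX h0).mul (((contDiffOn_jetTangential hX hY h0).mul
      (contDiffOn_jetTangential hX hZ h0)).sub (contDiffOn_jetInner hX hY hZ h0)))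

theorem contDiffOn_metricDensity (hX : ContDiffOn ℝ n X s) (hY : ContDiffOn ℝ n Y s)
    (hZ : ContDiffOn ℝ n Z s) (h0 : ∀ p ∈ s, (X p).1 ≠ 0) :
    ContDiffOn ℝ n (fun p => metricDensity (X p) (Y p) (Z p)) s :=
  (((contDiffOn_jetTangential hX hY h0).mul (contDiffOn_jetTangential hX hZ h0)).add
    ((contDiffOn_jetNormal hX hY h0).mul (contDiffOn_jetNormal hX hZ h0))).mul
    (contDiffOn_norm_fst hX h0)

end Smoothness

/-! ### Reconstruction of a tangent vector from its tangential and normal parts -/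

/-- The rotation by `π / 2` as a continuous linear map. -/
def rotL : Plane →L[ℝ] Plane :=
  LinearMap.toContinuousLinearMap
    { toFun := rot
      map_add' := fun x y => by ext i; fin_cases i <;> simp [rot]; ring
      map_smul' := fun r x => by ext i; fin_cases i <;> simp [rot] }

theorem eq_smul_add_smul_rot {p : Plane} (hp : p ≠ 0) (u : Plane) :
    u = (⟪p, u⟫_ℝ / ‖p‖ ^ 2) • p + (cross p u / ‖p‖ ^ 2) • rot p := by
  have hn : p 0 ^ 2 + p 1 ^ 2 ≠ 0 := by
    rw [← norm_sq_eq]; exact pow_ne_zero 2 (norm_ne_zero_iff.2 hp)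
  ext i
  fin_cases i <;> simp [rot, cross, inner_eq, norm_sq_eq] <;> field_simp <;> ring

theorem jetTangential_combination {x y : Jet} (h0 : x.1 ≠ 0) {a b : ℝ}
    (hy : y.1 = a • x.1 + b • rot x.1) : jetTangential x y = a := by
  have hn : x.1 0 ^ 2 + x.1 1 ^ 2 ≠ 0 := by
    rw [← norm_sq_eq]; exact pow_ne_zero 2 (norm_ne_zero_iff.2 h0)
  rw [jetTangential, hy]
  simp [rot, inner_eq, norm_sq_eq]
  field_simp
  ring

/-- With h' = a c' + b rot c', the normal part involves b only through b'. Prescribing both parts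
thus fixes a algebraically and b by one integration. -/
theorem jetNormal_combination {x y : Jet} (h0 : x.1 ≠ 0) {a a' b b' : ℝ}
    (hy : y.1 = a • x.1 + b • rot x.1)
    (hy' : y.2 = (a • x.2 + a' • x.1) + (b • rot x.2 + b' • rot x.1)) :
    jetNormal x y = jetCurvature x * a + b' / ‖x.1‖ := by
  have hn : ‖x.1‖ ≠ 0 := norm_ne_zero_iff.2 h0
  rw [jetNormal, jetTangential_combination h0 hy, hy, hy']
  have h2 := norm_sq_eq x.1
  simp only [jetCurvature, cross, rot, PiLp.add_apply, PiLp.smul_apply, smul_eq_mul]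
  simp
  field_simp
  rw [h2]
  ring

/-! ### Tangent vectors and their two parts -/

theorem contDiffOn_toFun (h : V) : ContDiffOn ℝ ∞ (toFun h) J := h.2.1

theorem toFun_zero_apply (h : V) : toFun h 0 = 0 := h.2.2.1

theorem dθ_toFun_zero (h : V) : dθ (toFun h) 0 1 = 0 := h.2.2.2

theorem toFun_coe (h : V) (θ : J) : toFun h θ = h.1 θ := by
  simp [toFun, ext]

theorem eq_of_eqOn {h k : V} (H : Set.EqOn (toFun h) (toFun k) J) : h = k := by
  refine Subtype.ext (funext fun θ => ?_)
  rw [← toFun_coe, ← toFun_coe, H θ.2]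

/-- A smooth function on the interval which satisfies the conditions at `0`, as an element
of `V`. -/
theorem exists_toFun_eqOn {f : ℝ → Plane} (hf : ContDiffOn ℝ ∞ f J) (h0 : f 0 = 0)
    (h1 : dθ f 0 1 = 0) : ∃ h : V, Set.EqOn (toFun h) f J := by
  have H : Set.EqOn (ext fun θ => f θ) f J := fun θ hθ => by
    simp [ext, Set.IccExtend_of_mem _ _ hθ]
  exact ⟨⟨fun θ => f θ, hf.congr H, (H zero_mem_J).trans h0, by
    rw [dθ_congr H zero_mem_J, h1]⟩, H⟩

theorem jet_toFun_add (h k : V) {θ : ℝ} (hθ : θ ∈ J) :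
    jet (toFun (h + k)) θ = jet (toFun h) θ + jet (toFun k) θ :=
  jet_add (contDiffOn_toFun h) (contDiffOn_toFun k) hθ

theorem jet_toFun_smul (r : ℝ) (h : V) {θ : ℝ} (hθ : θ ∈ J) :
    jet (toFun (r • h)) θ = r • jet (toFun h) θ :=
  jet_smul r (contDiffOn_toFun h) hθ

theorem jet_toFun_sub (h k : V) {θ : ℝ} (hθ : θ ∈ J) :
    jet (toFun (h - k)) θ = jet (toFun h) θ - jet (toFun k) θ :=
  jet_sub (contDiffOn_toFun h) (contDiffOn_toFun k) hθ

theorem contDiffOn_jet {γ : ℝ → V} (hγ : IsSmoothCurve γ) :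
    ContDiffOn ℝ ∞ (fun p : ℝ × ℝ => jet (toFun (γ p.1)) p.2) strip :=
  (contDiffOn_partialθ hγ).prodMk (contDiffOn_partialθ (contDiffOn_partialθ hγ))

theorem isSmoothCurve_const (h : V) : IsSmoothCurve fun _ => h :=
  (contDiffOn_toFun h).comp contDiffOn_snd fun _ hp => hp.2

/-- Two integrations from 0 suffice: one for the coefficient b of rot c' in h', one for h. Carrying
the time parameter along yields smoothness of the resulting curve in `V`. -/
theorem exists_curve_of_parts {γ : ℝ → V} (hγ : IsSmoothCurve γ)
    (hγM : ∀ t, γ t ∈ curvesModMot) {a e : ℝ × ℝ → ℝ} (ha : ContDiffOn ℝ ∞ a strip)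
    (he : ContDiffOn ℝ ∞ e strip) :
    ∃ η : ℝ → V, IsSmoothCurve η ∧ ∀ t, ∀ θ ∈ J,
      jetTangential (jet (toFun (γ t)) θ) (jet (toFun (η t)) θ) = a (t, θ) ∧
      jetNormal (jet (toFun (γ t)) θ) (jet (toFun (η t)) θ) = e (t, θ) := by
  set X : ℝ × ℝ → Jet := fun p => jet (toFun (γ p.1)) p.2 with hX
  have hXs : ContDiffOn ℝ ∞ X strip := contDiffOn_jet hγ
  have hX0 : ∀ p ∈ strip, (X p).1 ≠ 0 := fun p hp => (hγM p.1).1 p.2 hp.2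
  -- The value of b' forced by `jetNormal_combination`.
  set b' : ℝ × ℝ → ℝ := fun p => ‖(X p).1‖ * (e p - jetCurvature (X p) * a p) with hb'
  have hb's : ContDiffOn ℝ ∞ b' strip :=
    (contDiffOn_norm_fst hXs hX0).mul (he.sub ((contDiffOn_jetCurvature hXs hX0).mul ha))
  have hbs := contDiffOn_primitive hb's
  set g : ℝ × ℝ → Plane := fun p => a p • (X p).1 + primitive b' p • rotL (X p).1 with hg
  have hgs : ContDiffOn ℝ ∞ g strip :=
    (ha.smul hXs.fst).add (hbs.smul (rotL.contDiff.comp_contDiffOn hXs.fst))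
  have hGs := contDiffOn_primitive hgs
  have hGθ (t : ℝ) {θ : ℝ} (hθ : θ ∈ J) : dθ (fun θ => primitive g (t, θ)) θ = g (t, θ) :=
    partialθ_primitive hgs (mk_mem_strip hθ)
  have hη (t : ℝ) : ∃ h : V, Set.EqOn (toFun h) (fun θ => primitive g (t, θ)) J := by
    refine exists_toFun_eqOn ?_ ?_ ?_
    · exact hGs.comp (contDiff_prodMk_right t).contDiffOn fun θ hθ => mk_mem_strip hθ
    · simp [primitive]
    -- At θ = 0 the primitive of b' vanishes, so the new derivative is a multiple of c'(0), which is
    -- horizontal.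
    · rw [hGθ t zero_mem_J]
      have h1 : (X (t, 0)).1 1 = 0 := dθ_toFun_zero (γ t)
      simp [hg, primitive, h1]
  choose η hη using hη
  refine ⟨η, hGs.congr fun p hp => hη p.1 hp.2, fun t θ hθ => ?_⟩
  have hp : (t, θ) ∈ strip := mk_mem_strip hθ
  have h1 : (jet (toFun (η t)) θ).1 = a (t, θ) • (X (t, θ)).1 +
      primitive b' (t, θ) • rot (X (t, θ)).1 := (dθ_congr (hη t) hθ).trans (hGθ t hθ)
  have hXθ := hasDerivWithinAt_dθ (contDiffOn_dθ (contDiffOn_toFun (γ t))) hθ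
  have h2 : (jet (toFun (η t)) θ).2 = (a (t, θ) • (X (t, θ)).2 + partialθ a (t, θ) • (X (t, θ)).1) +
      (primitive b' (t, θ) • rot (X (t, θ)).2 + b' (t, θ) • rot (X (t, θ)).1) := by
    have hd := ((hasDerivWithinAt_partialθ ha t hθ).smul hXθ).add
      ((hasDerivWithinAt_partialθ hbs t hθ).smul
        (rotL.hasFDerivAt.comp_hasDerivWithinAt θ hXθ))
    rw [partialθ_primitive hb's hp] at hd
    refine (dθ_congr (fun x hx => (dθ_congr (hη t) hx).trans (hGθ t hx)) hθ).trans ?_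
    exact dθ_eq hθ hd
  refine ⟨jetTangential_combination (hX0 _ hp) h1, ?_⟩
  have hn : ‖(X (t, θ)).1‖ ≠ 0 := norm_ne_zero_iff.2 (hX0 _ hp)
  refine (jetNormal_combination (hX0 _ hp) h1 h2).trans ?_
  rw [hb']
  field_simp
  ring

/-- Vanishing parts give h' = b rot c' with b' = 0. The conditions at 0 then force b = 0 and h = 0.
-/
theorem eq_zero_of_parts {c : V} (hc : c ∈ curvesModMot) {h : V}
    (hT : ∀ θ ∈ J, jetTangential (jet (toFun c) θ) (jet (toFun h) θ) = 0)
    (hN : ∀ θ ∈ J, jetNormal (jet (toFun c) θ) (jet (toFun h) θ) = 0) : h = 0 := by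
  have hcs := contDiffOn_dθ (contDiffOn_toFun c)
  have hhs := contDiffOn_dθ (contDiffOn_toFun h)
  set b : ℝ → ℝ := fun θ => cross (dθ (toFun c) θ) (dθ (toFun h) θ) / ‖dθ (toFun c) θ‖ ^ 2 with hb
  have hbs : ContDiffOn ℝ ∞ b J := (contDiffOn_cross hcs hhs).div ((hcs.norm ℝ hc.1).pow 2)
    fun θ hθ => pow_ne_zero 2 (norm_ne_zero_iff.2 (hc.1 θ hθ))
  have h1 {θ : ℝ} (hθ : θ ∈ J) : dθ (toFun h) θ =
      (0 : ℝ) • dθ (toFun c) θ + b θ • rotL (dθ (toFun c) θ) := by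
    conv_lhs => rw [eq_smul_add_smul_rot (hc.1 θ hθ) (dθ (toFun h) θ)]
    congr 2
    exact hT θ hθ
  have hb0 {θ : ℝ} (hθ : θ ∈ J) : derivWithin b J θ = 0 := by
    have hcθ := hasDerivWithinAt_dθ hcs hθ
    have hd := ((hasDerivWithinAt_const θ J (0 : ℝ)).smul hcθ).add
      ((hbs.differentiableOn (by simp) θ hθ).hasDerivWithinAt.smul
        (rotL.hasFDerivAt.comp_hasDerivWithinAt θ hcθ))
    have h2 := (dθ_congr (fun x hx => h1 hx) hθ).trans (dθ_eq hθ hd)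
    have h3 := jetNormal_combination (x := jet (toFun c) θ) (y := jet (toFun h) θ)
      (hc.1 θ hθ) (h1 hθ) h2
    rw [hN θ hθ] at h3
    have hn : ‖(jet (toFun c) θ).1‖ ≠ 0 := norm_ne_zero_iff.2 (hc.1 θ hθ)
    simpa [hn] using h3.symm
  have hbz {θ : ℝ} (hθ : θ ∈ J) : b θ = 0 := by
    rw [constant_of_derivWithin_zero (hbs.differentiableOn (by simp))
      (fun x hx => hb0 (Set.Ico_subset_Icc_self hx)) θ hθ]
    -- Both c'(0) and h'(0) are horizontal, so their cross product vanishes.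
    simp [hb, cross, dθ_toFun_zero]
  refine eq_of_eqOn fun θ hθ => ?_
  rw [constant_of_derivWithin_zero ((contDiffOn_toFun h).differentiableOn (by simp))
    (fun x hx => ?_) θ hθ, toFun_zero_apply]
  · simp [toFun, ext, Set.IccExtend]
  · have := h1 (Set.Ico_subset_Icc_self hx)
    rw [hbz (Set.Ico_subset_Icc_self hx)] at this
    exact this.trans (by simp)

theorem eq_of_parts {c : V} (hc : c ∈ curvesModMot) {h k : V}
    (hT : ∀ θ ∈ J, jetTangential (jet (toFun c) θ) (jet (toFun h) θ) =
      jetTangential (jet (toFun c) θ) (jet (toFun k) θ))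
    (hN : ∀ θ ∈ J, jetNormal (jet (toFun c) θ) (jet (toFun h) θ) =
      jetNormal (jet (toFun c) θ) (jet (toFun k) θ)) : h = k := by
  refine sub_eq_zero.1 (eq_zero_of_parts hc (fun θ hθ => ?_) fun θ hθ => ?_)
  · rw [jet_toFun_sub _ _ hθ, jetTangential_sub, hT θ hθ, sub_self]
  · rw [jet_toFun_sub _ _ hθ, jetNormal_sub, hN θ hθ, sub_self]

/-! ### The metric as an inner product -/

theorem contDiffOn_jet_toFun (h : V) : ContDiffOn ℝ ∞ (jet (toFun h)) J :=
  (contDiffOn_dθ (contDiffOn_toFun h)).prodMk (contDiffOn_dθ (contDiffOn_dθ (contDiffOn_toFun h)))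

theorem metric_comm (c h k : ℝ → Plane) : metric c h k = metric c k h := by
  simp only [metric, mul_comm]

theorem metric_toFun_eq_integral {c : V} (hc : c ∈ curvesModMot) (h k : V) :
    metric (toFun c) (toFun h) (toFun k) = ∫ θ in (0 : ℝ)..(2 * Real.pi),
      metricDensity (jet (toFun c) θ) (jet (toFun h) θ) (jet (toFun k) θ) :=
  metric_eq_integral (contDiffOn_toFun c) (contDiffOn_toFun h) (contDiffOn_toFun k) hc.1

theorem continuousOn_metricDensity {c : V} (hc : c ∈ curvesModMot) (h k : V) :
    ContinuousOn (fun θ => metricDensity (jet (toFun c) θ) (jet (toFun h) θ) (jet (toFun k) θ)) J :=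
  (contDiffOn_metricDensity (contDiffOn_jet_toFun c) (contDiffOn_jet_toFun h)
    (contDiffOn_jet_toFun k) hc.1).continuousOn

theorem intervalIntegrable_metricDensity {c : V} (hc : c ∈ curvesModMot) (h k : V) :
    IntervalIntegrable
      (fun θ => metricDensity (jet (toFun c) θ) (jet (toFun h) θ) (jet (toFun k) θ))
      MeasureTheory.volume 0 (2 * Real.pi) :=
  (continuousOn_metricDensity hc h k).intervalIntegrable_of_Icc Real.two_pi_pos.le

theorem metric_add_left {c : V} (hc : c ∈ curvesModMot) (h k l : V) :
    metric (toFun c) (toFun (h + k)) (toFun l) =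
      metric (toFun c) (toFun h) (toFun l) + metric (toFun c) (toFun k) (toFun l) := by
  simp only [metric_toFun_eq_integral hc]
  rw [← intervalIntegral.integral_add (intervalIntegrable_metricDensity hc h l)
    (intervalIntegrable_metricDensity hc k l)]
  refine intervalIntegral.integral_congr fun θ hθ => ?_
  rw [Set.uIcc_of_le Real.two_pi_pos.le] at hθ
  simp only [jet_toFun_add h k hθ, metricDensity, jetTangential_add, jetNormal_add]
  ring

theorem metric_smul_left {c : V} (hc : c ∈ curvesModMot) (r : ℝ) (h l : V) :
    metric (toFun c) (toFun (r • h)) (toFun l) = r * metric (toFun c) (toFun h) (toFun l) := by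
  simp only [metric_toFun_eq_integral hc]
  rw [← intervalIntegral.integral_const_mul]
  refine intervalIntegral.integral_congr fun θ hθ => ?_
  rw [Set.uIcc_of_le Real.two_pi_pos.le] at hθ
  simp only [jet_toFun_smul r h hθ, metricDensity, jetTangential_smul, jetNormal_smul]
  ring

theorem metric_sub_left {c : V} (hc : c ∈ curvesModMot) (h k l : V) :
    metric (toFun c) (toFun (h - k)) (toFun l) =
      metric (toFun c) (toFun h) (toFun l) - metric (toFun c) (toFun k) (toFun l) := by
  rw [sub_eq_add_neg, ← neg_one_smul ℝ k, metric_add_left hc, metric_smul_left hc]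
  ring

theorem metric_self_pos {c : V} (hc : c ∈ curvesModMot) {h : V} (hh : h ≠ 0) :
    0 < metric (toFun c) (toFun h) (toFun h) := by
  rw [metric_toFun_eq_integral hc]
  have hnn : ∀ θ, 0 ≤ metricDensity (jet (toFun c) θ) (jet (toFun h) θ) (jet (toFun h) θ) :=
    fun θ => mul_nonneg (add_nonneg (mul_self_nonneg _) (mul_self_nonneg _)) (norm_nonneg _)
  refine intervalIntegral.integral_pos Real.two_pi_pos (continuousOn_metricDensity hc h h)
    (fun θ _ => hnn θ) ?_
  by_contra! H
  have hz : ∀ θ ∈ J, jetTangential (jet (toFun c) θ) (jet (toFun h) θ) = 0 ∧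
      jetNormal (jet (toFun c) θ) (jet (toFun h) θ) = 0 := fun θ hθ => by
    have h0 := le_antisymm (H θ hθ) (hnn θ)
    have hn : ‖(jet (toFun c) θ).1‖ ≠ 0 := norm_ne_zero_iff.2 (hc.1 θ hθ)
    rwa [metricDensity, mul_eq_zero, or_iff_left hn,
      mul_self_add_mul_self_eq_zero] at h0
  exact hh (eq_zero_of_parts hc (fun θ hθ => (hz θ hθ).1) fun θ hθ => (hz θ hθ).2)

/-- The strict Cauchy-Schwarz inequality. -/
theorem gram_pos {c : V} (hc : c ∈ curvesModMot) {h k : V} (hi : LinearIndependent ℝ ![h, k]) :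
    0 < gram c h k := by
  have hk : k ≠ 0 := hi.ne_zero 1
  have hkk := metric_self_pos hc hk
  -- The coefficient of the orthogonal projection onto k; the Gram determinant is G(h − rk, h − rk)
  -- G(k, k).
  set r := metric (toFun c) (toFun h) (toFun k) / metric (toFun c) (toFun k) (toFun k) with hr
  have hne : h - r • k ≠ 0 := fun h0 => by
    have := LinearIndependent.pair_iff.1 hi 1 (-r) (by rw [← h0]; module)
    exact one_ne_zero this.1
  have hp := metric_self_pos hc hne
  have e : metric (toFun c) (toFun (h - r • k)) (toFun (h - r • k)) =
      metric (toFun c) (toFun h) (toFun h) - 2 * r * metric (toFun c) (toFun h) (toFun k) +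
        r ^ 2 * metric (toFun c) (toFun k) (toFun k) := by
    rw [metric_sub_left hc, metric_smul_left hc, metric_comm _ (toFun h), metric_sub_left hc,
      metric_smul_left hc, metric_comm _ (toFun k) (toFun (h - r • k)), metric_sub_left hc,
      metric_smul_left hc,
      metric_comm _ (toFun k) (toFun h)]
    ring
  have hg : gram c h k = metric (toFun c) (toFun (h - r • k)) (toFun (h - r • k)) *
      metric (toFun c) (toFun k) (toFun k) := by
    rw [e, gram, hr]
    field_simp
    ring
  rw [hg]
  exact mul_pos hp hkk

/-! ### Existence and uniqueness of the Levi-Civita connection -/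

theorem jet_ne_zero {γ : ℝ → V} (hγM : ∀ t, γ t ∈ curvesModMot) :
    ∀ p ∈ strip, (jet (toFun (γ p.1)) p.2).1 ≠ 0 := fun p hp => (hγM p.1).1 p.2 hp.2

/-- Constant curves give the Christoffel symbols at a single point; general curves give smoothness
of the connection. -/
theorem exists_curve_christoffel {γ η ζ : ℝ → V} (hγ : IsSmoothCurve γ) (hη : IsSmoothCurve η)
    (hζ : IsSmoothCurve ζ) (hγM : ∀ t, γ t ∈ curvesModMot) :
    ∃ ξ : ℝ → V, IsSmoothCurve ξ ∧ ∀ t, ∀ θ ∈ J,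
      jetTangential (jet (toFun (γ t)) θ) (jet (toFun (ξ t)) θ) =
        christoffelTangential (jet (toFun (γ t)) θ) (jet (toFun (η t)) θ) (jet (toFun (ζ t)) θ) ∧
      jetNormal (jet (toFun (γ t)) θ) (jet (toFun (ξ t)) θ) =
        christoffelNormal (jet (toFun (γ t)) θ) (jet (toFun (η t)) θ) (jet (toFun (ζ t)) θ) :=
  exists_curve_of_parts hγ hγM
    (contDiffOn_christoffelTangential (contDiffOn_jet hγ) (contDiffOn_jet hη) (contDiffOn_jet hζ)
      (jet_ne_zero hγM))
    (contDiffOn_christoffelNormal (contDiffOn_jet hγ) (contDiffOn_jet hη) (contDiffOn_jet hζ)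
      (jet_ne_zero hγM))

/-- `u` is the Christoffel symbol of `h` and `k` at `c`. -/
def IsChristoffel (c h k u : V) : Prop :=
  ∀ θ ∈ J,
    jetTangential (jet (toFun c) θ) (jet (toFun u) θ) =
      christoffelTangential (jet (toFun c) θ) (jet (toFun h) θ) (jet (toFun k) θ) ∧
    jetNormal (jet (toFun c) θ) (jet (toFun u) θ) =
      christoffelNormal (jet (toFun c) θ) (jet (toFun h) θ) (jet (toFun k) θ)

theorem exists_isChristoffel {c : V} (hc : c ∈ curvesModMot) (h k : V) :
    ∃ u, IsChristoffel c h k u := by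
  obtain ⟨ξ, -, hξ⟩ := exists_curve_christoffel (isSmoothCurve_const c) (isSmoothCurve_const h)
    (isSmoothCurve_const k) fun _ => hc
  exact ⟨ξ 0, hξ 0⟩

theorem IsChristoffel.unique {c h k u w : V} (hc : c ∈ curvesModMot) (hu : IsChristoffel c h k u)
    (hw : IsChristoffel c h k w) : u = w :=
  eq_of_parts hc (fun θ hθ => (hu θ hθ).1.trans (hw θ hθ).1.symm)
    fun θ hθ => (hu θ hθ).2.trans (hw θ hθ).2.symm

theorem IsChristoffel.symm {c h k u : V} (hu : IsChristoffel c h k u) : IsChristoffel c k h u :=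
  fun θ hθ => ⟨(hu θ hθ).1.trans (christoffelTangential_comm _ _ _),
    (hu θ hθ).2.trans (christoffelNormal_comm _ _ _)⟩

theorem IsChristoffel.add {c h h' k u u' : V} (hu : IsChristoffel c h k u)
    (hu' : IsChristoffel c h' k u') : IsChristoffel c (h + h') k (u + u') := fun θ hθ => by
  rw [jet_toFun_add _ _ hθ, jet_toFun_add _ _ hθ, jetTangential_add, jetNormal_add,
    christoffelTangential_add, christoffelNormal_add, (hu θ hθ).1, (hu θ hθ).2, (hu' θ hθ).1,
    (hu' θ hθ).2]
  exact ⟨rfl, rfl⟩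

theorem IsChristoffel.smul {c h k u : V} (r : ℝ) (hu : IsChristoffel c h k u) :
    IsChristoffel c (r • h) k (r • u) := fun θ hθ => by
  rw [jet_toFun_smul _ _ hθ, jet_toFun_smul _ _ hθ, jetTangential_smul, jetNormal_smul,
    christoffelTangential_smul, christoffelNormal_smul, (hu θ hθ).1, (hu θ hθ).2]
  exact ⟨rfl, rfl⟩

open Classical in
/-- The Christoffel map of the Levi-Civita connection. -/
def christoffel (c h k : V) : V :=
  if hc : c ∈ curvesModMot then (exists_isChristoffel hc h k).choose else 0

theorem isChristoffel_christoffel {c : V} (hc : c ∈ curvesModMot) (h k : V) :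
    IsChristoffel c h k (christoffel c h k) := by
  rw [christoffel, dif_pos hc]
  exact (exists_isChristoffel hc h k).choose_spec

theorem christoffel_of_notMem {c : V} (hc : c ∉ curvesModMot) (h k : V) :
    christoffel c h k = 0 := dif_neg hc

theorem christoffel_add_left (c h h' k : V) :
    christoffel c (h + h') k = christoffel c h k + christoffel c h' k := by
  by_cases hc : c ∈ curvesModMot
  · exact (isChristoffel_christoffel hc _ _).unique hc
      ((isChristoffel_christoffel hc _ _).add (isChristoffel_christoffel hc _ _))
  · simp [christoffel_of_notMem hc]

theorem christoffel_smul_left (c : V) (r : ℝ) (h k : V) :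
    christoffel c (r • h) k = r • christoffel c h k := by
  by_cases hc : c ∈ curvesModMot
  · exact (isChristoffel_christoffel hc _ _).unique hc ((isChristoffel_christoffel hc _ _).smul r)
  · simp [christoffel_of_notMem hc]

theorem christoffel_comm (c h k : V) : christoffel c h k = christoffel c k h := by
  by_cases hc : c ∈ curvesModMot
  · exact (isChristoffel_christoffel hc _ _).unique hc (isChristoffel_christoffel hc _ _).symm
  · simp [christoffel_of_notMem hc]

/-- The Christoffel map of the Levi-Civita connection as a bilinear map. -/
def christoffelMap (c : V) : V →ₗ[ℝ] V →ₗ[ℝ] V :=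
  LinearMap.mk₂ ℝ (christoffel c) (christoffel_add_left c) (christoffel_smul_left c)
    (fun h k k' => by simp only [christoffel_comm c h, christoffel_add_left])
    (fun r h k => by simp only [christoffel_comm c h, christoffel_smul_left])

/-! ### Lines in the manifold and the Levi-Civita property -/

/-- The manifold of curves is open along lines. -/
theorem exists_forall_add_smul_mem {c : V} (hc : c ∈ curvesModMot) (m : V) :
    ∃ ε > 0, ∀ s : ℝ, |s| < ε → c + s • m ∈ curvesModMot := by
  have hcs := contDiffOn_dθ (contDiffOn_toFun c)
  have hms := contDiffOn_dθ (contDiffOn_toFun m)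
  obtain ⟨θ₀, hθ₀, hmin⟩ := isCompact_Icc.exists_isMinOn ⟨0, zero_mem_J⟩ hcs.continuousOn.norm
  obtain ⟨C, hC⟩ := isCompact_Icc.exists_bound_of_continuousOn hms.continuousOn
  set δ := ‖dθ (toFun c) θ₀‖ with hδ
  have hδ0 : 0 < δ := norm_pos_iff.2 (hc.1 θ₀ hθ₀)
  have hC0 : 0 ≤ C := (norm_nonneg _).trans (hC 0 zero_mem_J)
  -- δ is the minimum of |c'| and C bounds |m'|, so |s m'| < δ; adding 1 keeps the denominator
  -- positive if C = 0.
  refine ⟨δ / (C + 1), by positivity, fun s hs => ?_⟩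
  have hd {θ : ℝ} (hθ : θ ∈ J) :
      dθ (toFun (c + s • m)) θ = dθ (toFun c) θ + s • dθ (toFun m) θ :=
    congrArg Prod.fst ((jet_toFun_add c (s • m) hθ).trans
      (congrArg _ (jet_toFun_smul s m hθ)))
  have hsm {θ : ℝ} (hθ : θ ∈ J) : ‖s • dθ (toFun m) θ‖ < δ := by
    rw [norm_smul, Real.norm_eq_abs]
    calc |s| * ‖dθ (toFun m) θ‖ ≤ |s| * (C + 1) := by
          gcongr; exact (hC θ hθ).trans (by linarith)
      _ < δ := (lt_div_iff₀ (by positivity)).1 hs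
  refine ⟨fun θ hθ h0 => ?_, ?_⟩
  · rw [hd hθ, add_eq_zero_iff_eq_neg] at h0
    have h1 : δ ≤ ‖dθ (toFun c) θ‖ := hmin hθ
    rw [h0, norm_neg] at h1
    exact absurd (hsm hθ) (not_lt.2 h1)
  -- At 0 the perturbation is horizontal and shorter than |c'(0)|, so the derivative still points
  -- along the positive first axis.
  · have hρ : 0 < ‖dθ (toFun c) 0‖ := norm_pos_iff.2 (hc.1 0 zero_mem_J)
    have hc0 : dθ (toFun c) 0 0 = ‖dθ (toFun c) 0‖ := by
      have h1 := congrArg (fun w : Plane => w 0) hc.2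
      simp only [unitTangent, Ds, speed, PiLp.smul_apply, smul_eq_mul] at h1
      rw [inv_mul_eq_div, div_eq_iff hρ.ne'] at h1
      simpa using h1
    set p := dθ (toFun (c + s • m)) 0 with hp
    have hp1 : p 1 = 0 := dθ_toFun_zero _
    have hp0 : 0 < p 0 := by
      have h1 : p 0 = ‖dθ (toFun c) 0‖ + (s • dθ (toFun m) 0) 0 := by
        rw [hp, hd zero_mem_J, PiLp.add_apply, hc0]
      have h2 : δ ≤ ‖dθ (toFun c) 0‖ := hmin zero_mem_J
      have h3 := PiLp.norm_apply_le (s • dθ (toFun m) 0) 0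
      rw [Real.norm_eq_abs] at h3
      have h4 := neg_abs_le ((s • dθ (toFun m) 0) 0)
      have h5 := hsm zero_mem_J
      linarith
    have hn : ‖p‖ = p 0 := by
      rw [← abs_of_pos hp0, ← Real.sqrt_sq_eq_abs, ← Real.sqrt_sq (norm_nonneg p), norm_sq_eq, hp1]
      simp
    ext i
    simp only [unitTangent, Ds, speed]
    rw [← hp, hn]
    fin_cases i <;> simp [hp1, hp0.ne']

/-- A line through a curve can be bent so as to stay in the manifold, without changing it near
the base point. -/
theorem exists_smoothCurve_eventuallyEq {c : V} (hc : c ∈ curvesModMot) (m : V) :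
    ∃ γ : ℝ → V, IsSmoothCurve γ ∧ (∀ t, γ t ∈ curvesModMot) ∧
      ∀ᶠ t in nhds (0 : ℝ), γ t = c + t • m := by
  obtain ⟨ε, hε, hM⟩ := exists_forall_add_smul_mem hc m
  let φ : ContDiffBump (0 : ℝ) := ⟨ε / 2, ε, by positivity, by linarith⟩
  -- The bump is 1 near 0 and 0 for |t| ≥ ε, with values in [0, 1], so |t φ(t)| < ε for all t.
  refine ⟨fun t => c + (t * φ t) • m, ?_, fun t => hM _ ?_, ?_⟩
  · have hφ : ContDiff ℝ ∞ fun p : ℝ × ℝ => p.1 * φ p.1 :=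
      contDiff_fst.mul (φ.contDiff.comp contDiff_fst)
    exact (isSmoothCurve_const c).add (hφ.contDiffOn.smul (isSmoothCurve_const m))
  · by_cases ht : |t| < ε
    · rw [abs_mul, abs_of_nonneg φ.nonneg]
      exact (mul_le_of_le_one_right (abs_nonneg t) φ.le_one).trans_lt ht
    · have : φ t = 0 := φ.zero_of_le_dist (by simpa using not_lt.1 ht)
      simpa [this] using hε
  · filter_upwards [φ.eventuallyEq_one] with t ht
    simp [ht]

theorem hasDerivAt_jet_line {γ : ℝ → V} {c m : V}
    (hγ : ∀ᶠ t in nhds (0 : ℝ), γ t = c + t • m) {θ : ℝ} (hθ : θ ∈ J) :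
    HasDerivAt (fun t => jet (toFun (γ t)) θ) (jet (toFun m) θ) 0 := by
  have h : HasDerivAt (fun t : ℝ => jet (toFun c) θ + t • jet (toFun m) θ)
      (jet (toFun m) θ) 0 := by
    simpa using ((hasDerivAt_id (0 : ℝ)).smul_const (jet (toFun m) θ)).const_add (jet (toFun c) θ)
  refine h.congr_of_eventuallyEq ?_
  filter_upwards [hγ] with t ht
  rw [ht, jet_toFun_add _ _ hθ, jet_toFun_smul _ _ hθ]

theorem hasDerivAt_metric {c : V} (hc : c ∈ curvesModMot) (m h k : V) :
    HasDerivAt (fun t : ℝ => metric (toFun (c + t • m)) (toFun h) (toFun k))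
      (metric (toFun c) (toFun (christoffel c m h)) (toFun k)
        + metric (toFun c) (toFun h) (toFun (christoffel c m k))) 0 := by
  obtain ⟨γ, hγ, hγM, hγ0⟩ := exists_smoothCurve_eventuallyEq hc m
  have hγc : γ 0 = c := by simpa using hγ0.self_of_nhds
  have hf := contDiffOn_metricDensity (contDiffOn_jet hγ) (contDiffOn_jet (isSmoothCurve_const h))
    (contDiffOn_jet (isSmoothCurve_const k)) (jet_ne_zero hγM)
  have hd := hasDerivAt_integral_strip hf 0
  have hd' := hd.congr_of_eventuallyEq
    (f₁ := fun t : ℝ => metric (toFun (c + t • m)) (toFun h) (toFun k)) (by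
      filter_upwards [hγ0] with t ht
      rw [← ht, metric_toFun_eq_integral (hγM t)])
  refine hd'.congr_deriv ?_
  rw [metric_toFun_eq_integral hc, metric_toFun_eq_integral hc, ← intervalIntegral.integral_add
    (intervalIntegrable_metricDensity hc _ _) (intervalIntegrable_metricDensity hc _ _)]
  refine intervalIntegral.integral_congr fun θ hθ => ?_
  rw [Set.uIcc_of_le Real.two_pi_pos.le] at hθ
  have hh := isChristoffel_christoffel hc m h θ hθ
  have hk := isChristoffel_christoffel hc m k θ hθ
  rw [← hγc] at hh hk ⊢
  exact (hasDerivAt_metricDensity (hasDerivAt_jet_line hγ0 hθ) ((hγM 0).1 θ hθ) _ _ hh.1 hh.2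
    hk.1 hk.2).deriv

theorem isLeviCivita_christoffelMap : IsLeviCivita christoffelMap where
  smooth γ η ζ hγ hη hζ hγM := by
    obtain ⟨ξ, hξ, hξ'⟩ := exists_curve_christoffel hγ hη hζ hγM
    have : (fun t => christoffelMap (γ t) (η t) (ζ t)) = ξ := funext fun t =>
      (isChristoffel_christoffel (hγM t) _ _).unique (hγM t) (hξ' t)
    rwa [this]
  torsion_free c _ h k := christoffel_comm c h k
  metric_compatible _ hc m h k := hasDerivAt_metric hc m h k

/-- The trilinear form G(S(h, k), l) of the difference S of two connections is symmetric in h, k and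
skew in k, l. Permuting the arguments shows that it equals its own negative, and G is definite. -/
theorem IsLeviCivita.eq {Γ Γ' : V → V →ₗ[ℝ] V →ₗ[ℝ] V} (hΓ : IsLeviCivita Γ)
    (hΓ' : IsLeviCivita Γ') {c : V} (hc : c ∈ curvesModMot) : Γ c = Γ' c := by
  set S : V → V → V := fun h k => Γ c h k - Γ' c h k with hS
  have hsymm (h k : V) : S h k = S k h := by
    simp only [hS, hΓ.torsion_free c hc h k, hΓ'.torsion_free c hc h k]
  have hskew (m h k : V) : metric (toFun c) (toFun (S m h)) (toFun k) =
      -metric (toFun c) (toFun (S m k)) (toFun h) := by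
    have h1 := (hΓ.metric_compatible c hc m h k).unique (hΓ'.metric_compatible c hc m h k)
    rw [metric_comm _ (toFun h), metric_comm _ (toFun h)] at h1
    simp only [hS, metric_sub_left hc]
    linarith
  have hzero (h k l : V) : metric (toFun c) (toFun (S h k)) (toFun l) = 0 := by
    have h1 := hskew h k l
    have h2 := hskew l h k
    have h3 := hskew k l h
    rw [hsymm l h] at h2
    rw [hsymm k l] at h3
    rw [hsymm k h] at h3
    linarith
  refine LinearMap.ext fun h => LinearMap.ext fun k => ?_
  by_contra hne
  exact (metric_self_pos hc (sub_ne_zero.2 hne)).ne' (hzero h k _)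

theorem IsLeviCivita.isChristoffel {Γ : V → V →ₗ[ℝ] V →ₗ[ℝ] V} (hΓ : IsLeviCivita Γ) {c : V}
    (hc : c ∈ curvesModMot) (h k : V) : IsChristoffel c h k (Γ c h k) := by
  rw [hΓ.eq isLeviCivita_christoffelMap hc]
  exact isChristoffel_christoffel hc h k

/-! ### The curvature -/

/-- The equations defining the parts of Γ hold along a whole curve through c, so both sides may be
differentiated in time; the product rule splits the left side into two terms. -/
theorem IsLeviCivita.dΓ_spec {Γ : V → V →ₗ[ℝ] V →ₗ[ℝ] V} (hΓ : IsLeviCivita Γ) {c : V}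
    (hc : c ∈ curvesModMot) (m h k : V) :
    ContDiffOn ℝ ∞ (dΓ Γ c m h k) J ∧ ∀ θ ∈ J,
      jetTangentialDeriv (jet (toFun c) θ) (jet (toFun m) θ) (jet (toFun (Γ c h k)) θ)
          + jetTangential (jet (toFun c) θ) (jet (dΓ Γ c m h k) θ) =
        christoffelTangentialDeriv (jet (toFun c) θ) (jet (toFun m) θ) (jet (toFun h) θ)
          (jet (toFun k) θ) ∧
      jetNormalDeriv (jet (toFun c) θ) (jet (toFun m) θ) (jet (toFun (Γ c h k)) θ)
          + jetNormal (jet (toFun c) θ) (jet (dΓ Γ c m h k) θ) =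
        christoffelNormalDeriv (jet (toFun c) θ) (jet (toFun m) θ) (jet (toFun h) θ)
          (jet (toFun k) θ) := by
  obtain ⟨γ, hγ, hγM, hγ0⟩ := exists_smoothCurve_eventuallyEq hc m
  have hγc : γ 0 = c := by simpa using hγ0.self_of_nhds
  have hη := hΓ.smooth γ _ _ hγ (isSmoothCurve_const h) (isSmoothCurve_const k) hγM
  set f : ℝ × ℝ → Plane := fun p => toFun (Γ (γ p.1) h k) p.2 with hf
  have hfs : ContDiffOn ℝ ∞ f strip := hη
  have hdΓ : dΓ Γ c m h k = fun θ => partialt f (0, θ) := by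
    funext θ
    refine Filter.EventuallyEq.deriv_eq ?_
    filter_upwards [hγ0] with t ht
    simp only [hf, ht]
  refine ⟨?_, fun θ hθ => ?_⟩
  · rw [hdΓ]
    exact (contDiffOn_partialt hfs).comp (contDiff_prodMk_right 0).contDiffOn
      fun θ hθ => mk_mem_strip hθ
  have hp : ((0 : ℝ), θ) ∈ strip := mk_mem_strip hθ
  -- Commuting ∂_t with ∂_θ twice identifies the jet of the time derivative with the time derivative
  -- of the jet.
  have hY : HasDerivAt (fun t => jet (toFun (Γ (γ t) h k)) θ) (jet (dΓ Γ c m h k) θ) 0 := by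
    have h1 : (jet (dΓ Γ c m h k) θ).1 = partialt (partialθ f) (0, θ) := by
      rw [hdΓ]
      exact partialθ_partialt hfs hp
    have h2 : (jet (dΓ Γ c m h k) θ).2 = partialt (partialθ (partialθ f)) (0, θ) := by
      rw [hdΓ, ← partialθ_partialt (contDiffOn_partialθ hfs) hp]
      exact partialθ_congr (fun q hq => partialθ_partialt hfs hq) hp
    have h3 := (hasDerivAt_partialt (contDiffOn_partialθ hfs) 0 hθ).prodMk
      (hasDerivAt_partialt (contDiffOn_partialθ (contDiffOn_partialθ hfs)) 0 hθ)
    rw [← h1, ← h2] at h3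
    exact h3
  have hX := hasDerivAt_jet_line hγ0 hθ
  have h0 := (hγM 0).1 θ hθ
  have hchr (t : ℝ) := hΓ.isChristoffel (hγM t) h k θ hθ
  have hT := hasDerivAt_jetTangential hX hY h0
  have hN := hasDerivAt_jetNormal hX hY h0
  simp only [(hchr _).1] at hT
  simp only [(hchr _).2] at hN
  -- One function of t has been differentiated in two ways.
  exact ⟨(hγc ▸ hT).unique (hγc ▸ hasDerivAt_christoffelTangential hX h0 _ _),
    (hγc ▸ hN).unique (hγc ▸ hasDerivAt_christoffelNormal hX h0 _ _)⟩

theorem IsLeviCivita.metric_curvatureTensor {Γ : V → V →ₗ[ℝ] V →ₗ[ℝ] V} (hΓ : IsLeviCivita Γ)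
    {c : V} (hc : c ∈ curvesModMot) (h k : V) :
    metric (toFun c) (curvatureTensor Γ c h k k) (toFun h) =
      -3 * arcIntegral (toFun c) (fun θ =>
        (tangentialPart (toFun c) (toFun h) θ * normalPart (toFun c) (toFun k) θ
          - tangentialPart (toFun c) (toFun k) θ * normalPart (toFun c) (toFun h) θ) ^ 2) := by
  obtain ⟨hu, hu'⟩ := hΓ.dΓ_spec hc h k k
  obtain ⟨hw, hw'⟩ := hΓ.dΓ_spec hc k h k
  have hu'' := contDiffOn_toFun (Γ c h (Γ c k k))
  have hw'' := contDiffOn_toFun (Γ c k (Γ c h k))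
  have hR : ContDiffOn ℝ ∞ (curvatureTensor Γ c h k k) J := ((hu.sub hw).add hu'').sub hw''
  -- The curvature tensor is a plain function, not an element of `V`, so the version of the integral
  -- formula for smooth functions is needed.
  rw [metric_eq_integral (contDiffOn_toFun c) hR (contDiffOn_toFun h) hc.1, arcIntegral,
    ← intervalIntegral.integral_const_mul]
  refine intervalIntegral.integral_congr fun θ hθ => ?_
  rw [Set.uIcc_of_le Real.two_pi_pos.le] at hθ
  have hjet : jet (curvatureTensor Γ c h k k) θ = jet (dΓ Γ c h k k) θ - jet (dΓ Γ c k h k) θ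
      + jet (toFun (Γ c h (Γ c k k))) θ - jet (toFun (Γ c k (Γ c h k))) θ := by
    rw [curvatureTensor, jet_sub (f := _ - _ + _) ((hu.sub hw).add hu'') hw'' hθ,
      jet_add (f := _ - _) (hu.sub hw) hu'' hθ, jet_sub hu hw hθ]
  simp only [tangentialPart_eq_jetTangential,
    normalPart_eq_jetNormal (contDiffOn_toFun c) (contDiffOn_toFun h) hθ (hc.1 θ hθ),
    normalPart_eq_jetNormal (contDiffOn_toFun c) (contDiffOn_toFun k) hθ (hc.1 θ hθ), hjet]
  have i1 := hΓ.isChristoffel hc k k θ hθ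
  have i2 := hΓ.isChristoffel hc h k θ hθ
  have i3 := hΓ.isChristoffel hc h (Γ c k k) θ hθ
  have i4 := hΓ.isChristoffel hc k (Γ c h k) θ hθ
  exact metricDensity_curvature i1.1 i1.2 i2.1 i2.2 (hu' θ hθ).1 (hu' θ hθ).2 (hw' θ hθ).1
    (hw' θ hθ).2 i3.1 i3.2 i4.1 i4.2

theorem arcIntegral_sq_nonneg (c : ℝ → Plane) (f : ℝ → ℝ) :
    0 ≤ arcIntegral c fun θ => f θ ^ 2 :=
  intervalIntegral.integral_nonneg Real.two_pi_pos.le fun _ _ =>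
    mul_nonneg (sq_nonneg _) (norm_nonneg _)

end PlaneCurves

end

/-- The metric on open plane curves modulo motions has a unique Levi-Civita connection, and its
sectional curvatures are given by the stated formula; in particular they are non-positive. -/
theorem mainTheorem5 :
    (∃ Γ, PlaneCurves.IsLeviCivita Γ) ∧
    (∀ Γ Γ', PlaneCurves.IsLeviCivita Γ → PlaneCurves.IsLeviCivita Γ' →
      ∀ c ∈ PlaneCurves.curvesModMot, Γ c = Γ' c) ∧
    (∀ Γ, PlaneCurves.IsLeviCivita Γ →
      ∀ c ∈ PlaneCurves.curvesModMot, ∀ h k : PlaneCurves.V, LinearIndependent ℝ ![h, k] →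
        0 < PlaneCurves.gram c h k ∧
        PlaneCurves.sectionalCurvature Γ c h k =
          -3 * PlaneCurves.arcIntegral (PlaneCurves.toFun c) (fun θ =>
              (PlaneCurves.tangentialPart (PlaneCurves.toFun c) (PlaneCurves.toFun h) θ
                  * PlaneCurves.normalPart (PlaneCurves.toFun c) (PlaneCurves.toFun k) θ
                - PlaneCurves.tangentialPart (PlaneCurves.toFun c) (PlaneCurves.toFun k) θ
                  * PlaneCurves.normalPart (PlaneCurves.toFun c) (PlaneCurves.toFun h) θ) ^ 2)
            / PlaneCurves.gram c h k ∧
        PlaneCurves.sectionalCurvature Γ c h k ≤ 0) := by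
  refine ⟨⟨_, PlaneCurves.isLeviCivita_christoffelMap⟩, fun Γ Γ' hΓ hΓ' c hc => hΓ.eq hΓ' hc,
    fun Γ hΓ c hc h k hi => ?_⟩
  have hg := PlaneCurves.gram_pos hc hi
  have hs := congrArg (· / PlaneCurves.gram c h k) (hΓ.metric_curvatureTensor hc h k)
  refine ⟨hg, hs, hs.trans_le (div_nonpos_of_nonpos_of_nonneg ?_ hg.le)⟩
  exact mul_nonpos_of_nonpos_of_nonneg (by norm_num) (PlaneCurves.arcIntegral_sq_nonneg _ _)
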